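/- Let $d\ge 1$, let $\mathcal P\subset\mathbb R^d$ be a convex $d$-dimensional polytope (the convex hull of a finite set, with affine span $\mathbb R^d$) with $n$ distinct vertices, and let $x_1\le x_2\le\dots\le x_n$ be the $z_1$-coordinates of its vertices, listed with multiplicity. For $t\in\mathbb R$ let $m(t)=\#\{i : x_i=t\}$. Call the projected vertices simple if the $x_i$ are pairwise distinct; equivalently, the projection $\pi(z_1,\dots,z_d)=z_1$ is injective on the vertex set. Let $\mu^{(1)}_{\mathcal P}=\pi_*(\mu_{\mathcal P})$ be the pushforward under $\pi$ of Lebesgue measure restricted to $\mathcal P$. Then there is a measurable function $\rho:\mathbb R\to[0,\infty)$ such that $\mu^{(1)}_{\mathcal P}=\rho(x)\,dx$, such that $\rho$ vanishes outside $[x_1,x_n]$ and its closed support is $[x_1,x_n]$, and such that: 1. $\rho$ is piecewise polynomial of degree at most $d-1$ with breakpoints among the distinct projected vertex coordinates: on every interval of $\mathbb R$ containing none of the $x_i$ it coincides with a polynomial of degree at most $d-1$. 2. If the projected vertices are simple, then $\rho\in C^{d-2}(\mathbb R)$ (no condition if $d=1$). In general, for every $t\in\mathbb R$ with $m(t)\le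 d-1$, $\rho$ is of class $C^{d-1-m(t)}$ in a neighbourhood of $t$. 3. If the projected vertices are simple, then the $d$-th distributional derivative of $\rho\,dx$ is a discrete signed measure supported on the projected vertex set: $D^d(\rho\,dx)=\sum_{i=1}^n c_i\,\delta_{x_i}$ for some $c_1,\dots,c_n\in\mathbb R$. In general there are real numbers $c_{t,j}$ such that $D^d(\rho\,dx)=\sum_{t\in\{x_1,\dots,x_n\}}\ \sum_{0\le j<m(t)} c_{t,j}\,D^j\delta_t$. 4. If $\mathcal P$ is a simplex whose vertices have $z_1$-coordinates $y_0\le\dots\le y_d$, then for almost every $t$ $$\rho(t)=\operatorname{vol}(\mathcal P)\,\frac{d}{y_d-y_0}\,N(t\mid y_0,\dots,y_d),$$ where $N$ is the classical univariate B-spline of order $d$ (degree $d-1$) given by the Cox–de Boor recursion $N(t\mid y_0,y_1)=\mathbf 1_{[y_0,y_1)}(t)$ and, for $k\ge 2$, $$N(t\mid y_0,\dots,y_k)=\frac{t-y_0}{y_{k-1}-y_0}N(t\mid y_0,\dots,y_{k-1})+\frac{y_k-t}{y_k-y_1}N(t\mid y_1,\dots,y_k),$$ terms with vanishing denominator being omitted.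 -/

import Mathlib

open MeasureTheory
open scoped Distributions LineDeriv

/-- A convex `d`-polytope in `ℝ^d`: the convex hull of a finite set, of full dimension `d`. -/
structure IsConvexPolytope {d : ℕ} (P : Set (EuclideanSpace ℝ (Fin d))) : Prop where
  exists_finite : ∃ S : Set (EuclideanSpace ℝ (Fin d)), S.Finite ∧ P = convexHull ℝ S
  full_dim : affineSpan ℝ P = ⊤

/-- The projection `(z₁, …, z_d) ↦ z₁`. -/
def axisProj {d : ℕ} [NeZero d] (z : EuclideanSpace ℝ (Fin d)) : ℝ := z 0

/-- The pushforward under `axisProj` of Lebesgue measure restricted to `P`. -/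
noncomputable def projectedMeasure {d : ℕ} [NeZero d] (P : Set (EuclideanSpace ℝ (Fin d))) :
    Measure ℝ :=
  (volume.restrict P).map axisProj

/-- `f` is piecewise polynomial of degree at most `k` with breakpoints in `K`: on every interval
(bounded or not) that avoids `K` it agrees with one polynomial of degree at most `k`. -/
def IsPiecewisePolynomial (k : ℕ) (K : Set ℝ) (f : ℝ → ℝ) : Prop :=
  ∀ I : Set ℝ, I.OrdConnected → Disjoint I K →
    ∃ p : Polynomial ℝ, p.natDegree ≤ k ∧ ∀ t ∈ I, f t = p.eval t

/-- The number of indices `i` with `x i = t`. -/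
noncomputable def knotMultiplicity {n : ℕ} (x : Fin n → ℝ) (t : ℝ) : ℕ :=
  Set.ncard {i | x i = t}

/-- The distribution `φ ↦ ∫ φ dμ` on `ℝ` defined by a locally finite measure `μ`
(it is zero if `μ` is not locally finite). -/
noncomputable def measureDistribution (μ : Measure ℝ) : 𝓓'((⊤ : TopologicalSpace.Opens ℝ), ℝ) :=
  ContinuousLinearMap.toUniformConvergenceCLM (RingHom.id ℝ) ℝ _
    (TestFunction.integralAgainstBilinCLM (ContinuousLinearMap.mul ℝ ℝ) μ (fun _ => 1))

theorem measureDistribution_apply (μ : Measure ℝ) [IsLocallyFiniteMeasure μ]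
    (φ : 𝓓((⊤ : TopologicalSpace.Opens ℝ), ℝ)) :
    measureDistribution μ φ = ∫ t, φ t ∂μ := by
  have h : LocallyIntegrableOn (fun _ : ℝ => (1 : ℝ)) (⊤ : TopologicalSpace.Opens ℝ) μ :=
    (locallyIntegrable_const (1 : ℝ)).locallyIntegrableOn _
  refine (TestFunction.integralAgainstBilinCLM_eq_integral h).trans ?_
  simp

/-- The `j`-th distributional derivative on `ℝ`. -/
noncomputable def distribDeriv (j : ℕ) (T : 𝓓'((⊤ : TopologicalSpace.Opens ℝ), ℝ)) :
    𝓓'((⊤ : TopologicalSpace.Opens ℝ), ℝ) :=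
  (fun S : 𝓓'((⊤ : TopologicalSpace.Opens ℝ), ℝ) => ∂_{(1 : ℝ)} S)^[j] T

/-- The Dirac mass at `t`, as a distribution on `ℝ`. -/
noncomputable def diracDistribution (t : ℝ) : 𝓓'((⊤ : TopologicalSpace.Opens ℝ), ℝ) :=
  Distribution.delta t

/-- The univariate B-spline of order `d` (degree `d - 1`) with the `d + 1` knots
`y 0 ≤ ⋯ ≤ y d`, by the Cox–de Boor recursion. The usual convention that a term whose
denominator vanishes is dropped is the convention `a / 0 = 0`. -/
noncomputable def bspline : (d : ℕ) → (Fin (d + 1) → ℝ) → ℝ → ℝ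
  | 0, _, _ => 0
  | 1, y, t => (Set.Ico (y 0) (y 1)).indicator (fun _ => 1) t
  | d + 2, y, t =>
      (t - y 0) / (y (Fin.last (d + 1)).castSucc - y 0) *
          bspline (d + 1) (fun i => y i.castSucc) t +
        (y (Fin.last (d + 2)) - t) / (y (Fin.last (d + 2)) - y 1) *
          bspline (d + 1) (fun i => y i.succ) t

/-- The B-spline normalized to have integral one. -/
noncomputable def bsplineDensity (d : ℕ) (y : Fin (d + 1) → ℝ) (t : ℝ) : ℝ :=
  d / (y (Fin.last d) - y 0) * bspline d y t

/-! Parametrized by the order simplex, a simplex projects to a multiple of `simplexMeasure y`, which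
depends only on the first coordinates `y` of its vertices. The order simplex is a cone over the face
opposite its first vertex and, by symmetry, its last. Integration along rays from each apex gives
two Euler identities. With a, b the first and last knots, their difference is the derivative rule
`mul_integral_deriv_simplexMeasure`: weakly, (b - a) μ_y' = μ_init - μ_tail. Applied to (x - a)φ and
(b - x)φ they give the weak Cox–de Boor recursion `integral_simplexMeasure_recursion`, which
identifies μ_y with a multiple of the B-spline (`bspline_integral`).

The derivative rule drives two inductions on the dimension. Pointwise, the density of μ_y is the
difference of the distribution functions of its two end faces, divided by b - a. Repeated
integration from Heaviside steps therefore yields combinations of truncated powers (s - t)₊ ^ (k -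
j) with j below the multiplicity of t (`simplexDensity_mem_truncSpan`), from which polynomiality and
smoothness are read off. Distributionally, d derivatives reduce μ_y to derivatives of Dirac masses,
with the same bound on j (`distribDeriv_simplexMeasure_mem_diracSpan`). Both inductions stop early
at a family of coinciding knots, where the measure is a point mass; this is where multiplicity
enters.

A polytope is reduced to simplices by a regular triangulation (`exists_triangulation`): lift the
vertices to generic heights and project the lower hull, found by linear programming. Equality up to
null sets suffices, so only points off all proper affine spans of vertices are examined. No new
vertices appear, so the multiplicities in a cell are at most those of the polytope, and both spans
are stable under summing over cells. -/

/-- The order simplex `1 ≥ u 0 ≥ ⋯ ≥ u (d - 1) ≥ 0`. -/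
def orderSimplex (d : ℕ) : Set (Fin d → ℝ) := {u | Antitone u ∧ ∀ i, u i ∈ Set.Icc (0 : ℝ) 1}

/-- The affine parametrization of the simplex with vertices `y` by the order simplex. -/
def pathSum {d : ℕ} {V : Type*} [AddCommGroup V] [Module ℝ V] (y : Fin (d + 1) → V)
    (u : Fin d → ℝ) : V :=
  y 0 + ∑ i, u i • (y i.succ - y i.castSucc)

/-- The image of Lebesgue measure on the order simplex under the affine map to the line that sends
the vertices to `y`. -/
noncomputable def simplexMeasure {d : ℕ} (y : Fin (d + 1) → ℝ) : Measure ℝ :=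
  (volume.restrict (orderSimplex d)).map (pathSum y)

/-! ### The order simplex as a cone, and its images on the line -/

theorem isClosed_orderSimplex (d : ℕ) : IsClosed (orderSimplex d) := by
  have : orderSimplex d = (⋂ (i : Fin d) (j : Fin d) (_ : i ≤ j), {u | u j ≤ u i}) ∩
      ⋂ i : Fin d, {u | u i ∈ Set.Icc (0 : ℝ) 1} := by
    ext u; simp [orderSimplex, Antitone]
  rw [this]
  refine IsClosed.inter ?_ ?_
  · exact isClosed_iInter fun i => isClosed_iInter fun j => isClosed_iInter fun _ =>
      isClosed_le (continuous_apply j) (continuous_apply i)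
  · exact isClosed_iInter fun i => isClosed_Icc.preimage (continuous_apply i)

theorem measurableSet_orderSimplex (d : ℕ) : MeasurableSet (orderSimplex d) :=
  (isClosed_orderSimplex d).measurableSet

theorem isCompact_orderSimplex (d : ℕ) : IsCompact (orderSimplex d) := by
  refine (isCompact_Icc (a := (0 : Fin d → ℝ)) (b := 1)).of_isClosed_subset
    (isClosed_orderSimplex d) ?_
  intro u hu
  exact ⟨fun i => (hu.2 i).1, fun i => (hu.2 i).2⟩

theorem continuous_pathSum {d : ℕ} (y : Fin (d + 1) → ℝ) : Continuous (pathSum y) := by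
  unfold pathSum; fun_prop

instance {d : ℕ} : IsFiniteMeasure (volume.restrict (orderSimplex d)) :=
  ⟨by simpa using (isCompact_orderSimplex d).measure_lt_top⟩

instance {d : ℕ} (y : Fin (d + 1) → ℝ) : IsFiniteMeasure (simplexMeasure y) := by
  unfold simplexMeasure; infer_instance

theorem integral_simplexMeasure {d : ℕ} (y : Fin (d + 1) → ℝ) {φ : ℝ → ℝ} (hφ : Continuous φ) :
    ∫ x, φ x ∂simplexMeasure y = ∫ u in orderSimplex d, φ (pathSum y u) := by
  rw [simplexMeasure, integral_map (continuous_pathSum y).aemeasurable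
    hφ.aestronglyMeasurable]

theorem Continuous.integrable_simplexMeasure {d : ℕ} {φ : ℝ → ℝ} (hφ : Continuous φ)
    (y : Fin (d + 1) → ℝ) :
    Integrable φ (simplexMeasure y) := by
  rw [simplexMeasure, integrable_map_measure hφ.aestronglyMeasurable
    (continuous_pathSum y).aemeasurable]
  exact (hφ.comp (continuous_pathSum y)).continuousOn.integrableOn_compact
    (isCompact_orderSimplex d)

/-- The cone structure: the slice with first coordinate r is the face opposite `y 0`, contracted
towards `y 0` by the factor r. -/
theorem pathSum_cons {d : ℕ} {V : Type*} [AddCommGroup V] [Module ℝ V] (y : Fin (d + 2) → V)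
    (r : ℝ) (u : Fin d → ℝ) :
    pathSum y (Fin.cons r (r • u)) = y 0 + r • (pathSum (Fin.tail y) u - y 0) := by
  simp only [pathSum, Fin.sum_univ_succ, Fin.cons_zero, Fin.cons_succ, Fin.tail, Pi.smul_apply,
    smul_assoc, ← Finset.smul_sum, Fin.succ_castSucc]
  simp only [Fin.castSucc_zero]
  module

theorem cons_smul_mem_orderSimplex {d : ℕ} {r : ℝ} (hr : 0 ≤ r) (hr1 : r ≤ 1) {u : Fin d → ℝ}
    (hu : u ∈ orderSimplex d) : (Fin.cons r (r • u) : Fin (d + 1) → ℝ) ∈ orderSimplex (d + 1) := by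
  refine ⟨?_, ?_⟩
  · intro i j hij
    induction i using Fin.cases with
    | zero =>
      induction j using Fin.cases with
      | zero => exact le_rfl
      | succ j => simpa using mul_le_of_le_one_right hr (hu.2 j).2
    | succ i =>
      induction j using Fin.cases with
      | zero => simp at hij
      | succ j => simpa using mul_le_mul_of_nonneg_left (hu.1 (Fin.succ_le_succ_iff.1 hij)) hr
  · intro i
    induction i using Fin.cases with
    | zero => exact ⟨hr, hr1⟩
    | succ i =>
      exact ⟨by simpa using mul_nonneg hr (hu.2 i).1,
        by simpa using mul_le_one₀ hr1 (hu.2 i).1 (hu.2 i).2⟩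

theorem exists_of_cons_mem_orderSimplex {d : ℕ} {r : ℝ} {w : Fin d → ℝ}
    (h : (Fin.cons r w : Fin (d + 1) → ℝ) ∈ orderSimplex (d + 1)) :
    0 ≤ r ∧ r ≤ 1 ∧ ∃ u ∈ orderSimplex d, w = r • u := by
  have h0 : 0 ≤ r ∧ r ≤ 1 := by simpa using h.2 0
  refine ⟨h0.1, h0.2, ?_⟩
  have hw : ∀ i, 0 ≤ w i := fun i => by simpa using (h.2 i.succ).1
  have hwr : ∀ i, w i ≤ r := fun i => by simpa using h.1 (Fin.zero_le i.succ)
  have hanti : Antitone w := fun i j hij => by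
    simpa using h.1 (Fin.succ_le_succ_iff.2 hij)
  rcases h0.1.eq_or_lt with rfl | hr
  · refine ⟨0, ⟨fun _ _ _ => le_rfl, fun i => by simp⟩, ?_⟩
    ext i
    simpa using le_antisymm (hwr i) (hw i)
  · refine ⟨r⁻¹ • w, ⟨fun i j hij => ?_, fun i => ⟨?_, ?_⟩⟩, ?_⟩
    · simpa using mul_le_mul_of_nonneg_left (hanti hij) (inv_nonneg.2 hr.le)
    · simpa using mul_nonneg (inv_nonneg.2 hr.le) (hw i)
    · have := hwr i
      simp only [Pi.smul_apply, smul_eq_mul]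
      rw [inv_mul_le_iff₀ hr]; simpa using this
    · rw [smul_inv_smul₀ hr.ne']

open scoped Pointwise in
theorem preimage_cons_orderSimplex {d : ℕ} {r : ℝ} (hr : 0 ≤ r) (hr1 : r ≤ 1) :
    {w : Fin d → ℝ | (Fin.cons r w : Fin (d + 1) → ℝ) ∈ orderSimplex (d + 1)} =
      r • orderSimplex d := by
  ext w
  constructor
  · intro h
    obtain ⟨-, -, u, hu, rfl⟩ := exists_of_cons_mem_orderSimplex h
    exact Set.smul_mem_smul_set hu
  · rintro ⟨u, hu, rfl⟩
    exact cons_smul_mem_orderSimplex hr hr1 hu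

-- Fubini in the first coordinate: the slice at r is r times the lower order simplex, and rescaling
-- it contributes the Jacobian r ^ d.
open scoped Pointwise in
theorem setIntegral_orderSimplex_succ {d : ℕ} {F : (Fin (d + 1) → ℝ) → ℝ} (hF : Continuous F) :
    ∫ u in orderSimplex (d + 1), F u =
      ∫ r in (0 : ℝ)..1, r ^ d * ∫ u in orderSimplex d, F (Fin.cons r (r • u)) := by
  have hmp := (volume_preserving_piFinSuccAbove (fun _ : Fin (d + 1) => ℝ) 0).symm
  have hint : Integrable ((orderSimplex (d + 1)).indicator F) := by
    rw [integrable_indicator_iff (measurableSet_orderSimplex _)]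
    exact hF.continuousOn.integrableOn_compact (isCompact_orderSimplex _)
  rw [← integral_indicator (measurableSet_orderSimplex _), ← hmp.integral_comp'
    (g := (orderSimplex (d + 1)).indicator F), Measure.volume_eq_prod, integral_prod]
  swap
  · rw [← Measure.volume_eq_prod]
    exact (hmp.integrable_comp_emb (MeasurableEquiv.measurableEmbedding _)).2 hint
  have hval : ∀ (r : ℝ) (w : Fin d → ℝ),
      (MeasurableEquiv.piFinSuccAbove (fun _ : Fin (d + 1) => ℝ) 0).symm (r, w) =
        (Fin.cons r w : Fin (d + 1) → ℝ) := fun r w => by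
    simp [MeasurableEquiv.piFinSuccAbove, Fin.insertNthEquiv]
  simp_rw [hval]
  rw [intervalIntegral.integral_of_le zero_le_one, ← integral_Icc_eq_integral_Ioc,
    ← integral_indicator measurableSet_Icc]
  refine integral_congr_ae ?_
  -- The slice r = 0 is discarded as null, since the rescaling formula needs r > 0.
  filter_upwards [Measure.ae_ne volume (0 : ℝ)] with r hr0
  by_cases hr : r ∈ Set.Icc (0 : ℝ) 1
  · have hpos : 0 < r := lt_of_le_of_ne hr.1 (Ne.symm hr0)
    rw [Set.indicator_of_mem hr]
    have h1 : (fun w : Fin d → ℝ => (orderSimplex (d + 1)).indicator F (Fin.cons r w)) =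
        (r • orderSimplex d).indicator (fun w => F (Fin.cons r w)) := by
      rw [← preimage_cons_orderSimplex hr.1 hr.2]
      ext w; rfl
    have hms : MeasurableSet (r • orderSimplex d) :=
      ((isClosed_orderSimplex d).smul₀ r).measurableSet
    rw [h1, integral_indicator hms]
    have h2 := Measure.setIntegral_comp_smul_of_pos (volume : Measure (Fin d → ℝ))
      (fun w => F (Fin.cons r w)) (orderSimplex d) hpos
    rw [h2]
    simp only [Module.finrank_fin_fun, smul_eq_mul]
    rw [← mul_assoc, mul_inv_cancel₀ (pow_ne_zero _ hr0), one_mul]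
  · rw [Set.indicator_of_notMem hr]
    have h1 : ∀ w : Fin d → ℝ, (orderSimplex (d + 1)).indicator F (Fin.cons r w) = 0 := by
      intro w
      refine Set.indicator_of_notMem (fun h => hr ?_) _
      obtain ⟨h1, h2, -⟩ := exists_of_cons_mem_orderSimplex h
      exact ⟨h1, h2⟩
    simp [h1]

theorem integral_simplexMeasure_succ {d : ℕ} (y : Fin (d + 2) → ℝ) {φ : ℝ → ℝ}
    (hφ : Continuous φ) :
    ∫ x, φ x ∂simplexMeasure y =
      ∫ z, (∫ r in (0 : ℝ)..1, r ^ d * φ (y 0 + r * (z - y 0))) ∂simplexMeasure (Fin.tail y) := by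
  have hc : Continuous fun z : ℝ => ∫ r in (0 : ℝ)..1, r ^ d * φ (y 0 + r * (z - y 0)) := by
    apply intervalIntegral.continuous_parametric_intervalIntegral_of_continuous'
    fun_prop
  rw [integral_simplexMeasure _ hφ, integral_simplexMeasure _ hc,
    setIntegral_orderSimplex_succ (F := fun u => φ (pathSum y u))
      (hφ.comp (continuous_pathSum y))]
  simp only [pathSum_cons, smul_eq_mul,
    intervalIntegral.integral_of_le zero_le_one, ← integral_const_mul]
  refine integral_integral_swap ?_
  rw [Measure.prod_restrict]
  have hcont : Continuous (Function.uncurry fun (r : ℝ) (u : Fin d → ℝ) =>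
      r ^ d * φ (y 0 + r * (pathSum (Fin.tail y) u - y 0))) := by
    have := continuous_pathSum (Fin.tail y)
    unfold Function.uncurry
    fun_prop
  exact (hcont.continuousOn.integrableOn_compact
    (isCompact_Icc.prod (isCompact_orderSimplex d))).mono_set
      (Set.prod_mono Set.Ioc_subset_Icc_self subset_rfl)

/-- Reversing the vertices corresponds to the volume-preserving symmetry u ↦ 1 - u ∘ rev of the
order simplex. It transfers results about the apex `y 0` to the last vertex. -/
theorem simplexMeasure_comp_rev {d : ℕ} (y : Fin (d + 1) → ℝ) :
    simplexMeasure (y ∘ Fin.rev) = simplexMeasure y := by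
  let e : (Fin d → ℝ) → (Fin d → ℝ) := fun u => 1 - u ∘ Fin.rev
  have he : MeasurePreserving e := by
    have h1 := volume_measurePreserving_piCongrLeft (fun _ : Fin d => ℝ) Fin.revPerm
    have h2 := Measure.measurePreserving_sub_left (volume : Measure (Fin d → ℝ)) 1
    have heq : e = (fun u => 1 - u) ∘
        MeasurableEquiv.piCongrLeft (fun _ : Fin d => ℝ) Fin.revPerm := ?_
    · rw [heq]
      exact h2.comp h1
    refine funext fun u => funext fun i => ?_
    simp only [e, Function.comp, Pi.sub_apply]
    congr 1
    have := MeasurableEquiv.piCongrLeft_apply_apply (β := fun _ : Fin d => ℝ) Fin.revPerm u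
      (Fin.rev i)
    simpa using this.symm
  have hpre : e ⁻¹' orderSimplex d = orderSimplex d := by
    ext u
    constructor
    · rintro ⟨h1, h2⟩
      refine ⟨fun i j hij => ?_, fun i => ?_⟩
      · have := h1 (Fin.rev_le_rev.2 hij)
        simp only [e, Pi.sub_apply, Pi.one_apply, Function.comp, Fin.rev_rev] at this
        linarith
      · simpa [e, and_comm] using h2 (Fin.rev i)
    · rintro ⟨h1, h2⟩
      refine ⟨fun i j hij => ?_, fun i => ?_⟩
      · have := h1 (Fin.rev_le_rev.2 hij)
        simp only [e, Pi.sub_apply, Pi.one_apply, Function.comp]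
        linarith
      · simpa [e, and_comm] using h2 (Fin.rev i)
  have hsum : ∀ u, pathSum y (e u) = pathSum (y ∘ Fin.rev) u := by
    intro u
    have h1 : ∑ i : Fin d, (y i.succ - y i.castSucc) = y (Fin.last d) - y 0 := by
      rw [Finset.sum_sub_distrib]
      have := (Fin.sum_univ_succ y).symm.trans (Fin.sum_univ_castSucc y)
      linarith
    have h2 : ∑ i : Fin d, u (Fin.rev i) * (y i.succ - y i.castSucc) =
        ∑ i : Fin d, u i * (y i.rev.succ - y i.rev.castSucc) := by
      rw [← Equiv.sum_comp Fin.revPerm]; simp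
    simp only [pathSum, e, Pi.sub_apply, Function.comp, smul_eq_mul, sub_mul, Pi.one_apply,
      one_mul, Finset.sum_sub_distrib, h1, h2, Fin.rev_zero, Fin.rev_succ, Fin.rev_castSucc]
    have h3 : ∀ i : Fin d, u i * (y i.rev.castSucc - y i.rev.succ) =
      - (u i * (y i.rev.succ - y i.rev.castSucc)) := fun i => by ring
    simp only [mul_sub, Finset.sum_sub_distrib]
    ring
  have : (volume.restrict (orderSimplex d)).map e = volume.restrict (orderSimplex d) := by
    conv_lhs => rw [← hpre]
    rw [← Measure.restrict_map he.measurable (measurableSet_orderSimplex d), he.map_eq]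
  rw [simplexMeasure, simplexMeasure]
  conv_rhs => rw [← this]
  rw [Measure.map_map (continuous_pathSum y).measurable he.measurable]
  congr 1
  ext u
  exact (hsum u).symm

/-! ### Euler identities, the derivative rule and the weak recursion -/

/-- Euler's identity for the cone with apex `y 0`: integrate the derivative of r ^ (d + 1) * φ along
each ray from the apex; the boundary term at r = 1 lives on the opposite face. -/
theorem integral_simplexMeasure_euler_tail {d : ℕ} (y : Fin (d + 2) → ℝ) {φ : ℝ → ℝ}
    (hφ : ContDiff ℝ 1 φ) :
    ∫ x, (x - y 0) * deriv φ x ∂simplexMeasure y =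
      ∫ x, φ x ∂simplexMeasure (Fin.tail y) - (d + 1) * ∫ x, φ x ∂simplexMeasure y := by
  have hφ' : Continuous (deriv φ) := hφ.continuous_deriv le_rfl
  have hφc := hφ.continuous
  have hc : Continuous fun z : ℝ => ∫ r in (0 : ℝ)..1, r ^ d * φ (y 0 + r * (z - y 0)) := by
    apply intervalIntegral.continuous_parametric_intervalIntegral_of_continuous'
    fun_prop
  rw [integral_simplexMeasure_succ y hφc, integral_simplexMeasure_succ y (by fun_prop),
    ← integral_const_mul, ← integral_sub (hφc.integrable_simplexMeasure _)
      (Continuous.integrable_simplexMeasure (by fun_prop) _)]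
  refine integral_congr_ae (ae_of_all _ fun z => ?_)
  have hd : ∀ r : ℝ, HasDerivAt (fun r : ℝ => r ^ (d + 1) * φ (y 0 + r * (z - y 0)))
      ((d + 1) * (r ^ d * φ (y 0 + r * (z - y 0))) +
        r ^ d * ((y 0 + r * (z - y 0) - y 0) * deriv φ (y 0 + r * (z - y 0)))) r := by
    intro r
    have h1 : HasDerivAt (fun r : ℝ => y 0 + r * (z - y 0)) (z - y 0) r := by
      simpa using ((hasDerivAt_id r).mul_const (z - y 0)).const_add (y 0)
    have h2 := ((hφ.differentiable one_ne_zero) (y 0 + r * (z - y 0))).hasDerivAt.comp r h1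
    refine ((hasDerivAt_pow (d + 1) r).mul h2).congr_deriv ?_
    simp only [Function.comp, Nat.add_sub_cancel, Nat.cast_add, Nat.cast_one]
    ring
  have hFTC := intervalIntegral.integral_eq_sub_of_hasDerivAt (a := 0) (b := 1)
    (fun r _ => hd r) (by apply Continuous.intervalIntegrable; fun_prop)
  rw [intervalIntegral.integral_add (by apply Continuous.intervalIntegrable; fun_prop)
    (by apply Continuous.intervalIntegrable; fun_prop), intervalIntegral.integral_const_mul] at hFTC
  simp only [one_pow, one_mul, add_sub_cancel, zero_pow (Nat.succ_ne_zero d), zero_mul,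
    sub_zero] at hFTC
  simp only
  linarith

theorem integral_simplexMeasure_euler_init {d : ℕ} (y : Fin (d + 2) → ℝ) {φ : ℝ → ℝ}
    (hφ : ContDiff ℝ 1 φ) :
    ∫ x, (x - y (Fin.last (d + 1))) * deriv φ x ∂simplexMeasure y =
      ∫ x, φ x ∂simplexMeasure (Fin.init y) - (d + 1) * ∫ x, φ x ∂simplexMeasure y := by
  have h := integral_simplexMeasure_euler_tail (y ∘ Fin.rev) hφ
  have h2 : Fin.tail (y ∘ Fin.rev) = Fin.init y ∘ Fin.rev := by
    ext i; simp [Fin.tail, Fin.init, Fin.rev_succ]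
  rw [h2, simplexMeasure_comp_rev, simplexMeasure_comp_rev] at h
  simpa using h

/-- Subtracting the two Euler identities leaves φ' with a constant factor. In this multiplied form
the rule also covers equal first and last knots. -/
theorem mul_integral_deriv_simplexMeasure {d : ℕ} (y : Fin (d + 2) → ℝ) {φ : ℝ → ℝ}
    (hφ : ContDiff ℝ 1 φ) :
    (y (Fin.last (d + 1)) - y 0) * ∫ x, deriv φ x ∂simplexMeasure y =
      ∫ x, φ x ∂simplexMeasure (Fin.tail y) - ∫ x, φ x ∂simplexMeasure (Fin.init y) := by
  have hφ' : Continuous (deriv φ) := hφ.continuous_deriv le_rfl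
  have h1 := integral_simplexMeasure_euler_tail y hφ
  have h2 := integral_simplexMeasure_euler_init y hφ
  rw [← integral_const_mul]
  have h3 : ∀ x, (y (Fin.last (d + 1)) - y 0) * deriv φ x =
    (x - y 0) * deriv φ x - (x - y (Fin.last (d + 1))) * deriv φ x := fun x => by ring
  simp_rw [h3]
  rw [integral_sub (Continuous.integrable_simplexMeasure (by fun_prop) _)
    (Continuous.integrable_simplexMeasure (by fun_prop) _), h1, h2]
  ring

/-- The weak form of the Cox–de Boor recursion. -/
theorem integral_simplexMeasure_recursion {d : ℕ} (y : Fin (d + 2) → ℝ) {φ : ℝ → ℝ}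
    (hφ : ContDiff ℝ 1 φ) :
    d * (y (Fin.last (d + 1)) - y 0) * ∫ x, φ x ∂simplexMeasure y =
      ∫ x, (x - y 0) * φ x ∂simplexMeasure (Fin.init y) +
        ∫ x, (y (Fin.last (d + 1)) - x) * φ x ∂simplexMeasure (Fin.tail y) := by
  have hφ' : Continuous (deriv φ) := hφ.continuous_deriv le_rfl
  have hφc := hφ.continuous
  set a := y 0
  set b := y (Fin.last (d + 1))
  have hd : ∀ x, HasDerivAt φ (deriv φ x) x :=
    fun x => ((hφ.differentiable one_ne_zero) x).hasDerivAt
  have hd1 : ∀ x, deriv (fun x => (x - a) * φ x) x = φ x + (x - a) * deriv φ x := fun x => by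
    have := ((((hasDerivAt_id x).sub_const a).mul (hd x)).deriv)
    simp only [id, one_mul] at this
    exact this
  have hd2 : ∀ x, deriv (fun x => (b - x) * φ x) x = -φ x + (b - x) * deriv φ x := fun x => by
    have := ((((hasDerivAt_id x).const_sub b).mul (hd x)).deriv)
    simp only [id, neg_mul, one_mul] at this
    exact this
  -- The multipliers x - a and b - x are chosen so that the terms in φ' of the two Euler identities
  -- cancel.
  have h1 := integral_simplexMeasure_euler_init y (φ := fun x => (x - a) * φ x) (by fun_prop)
  have h2 := integral_simplexMeasure_euler_tail y (φ := fun x => (b - x) * φ x) (by fun_prop)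
  simp only [hd1, hd2] at h1 h2
  have hI : ∀ {g : ℝ → ℝ}, Continuous g → Integrable g (simplexMeasure y) :=
    fun hg => hg.integrable_simplexMeasure y
  have e1 : ∫ x, (x - a) * φ x ∂simplexMeasure (Fin.init y) =
      ∫ x, ((x - b) * (φ x + (x - a) * deriv φ x) + (d + 1) * ((x - a) * φ x))
        ∂simplexMeasure y := by
    rw [integral_add (hI (by fun_prop)) (hI (by fun_prop)), h1, integral_const_mul]; ring
  have e2 : ∫ x, (b - x) * φ x ∂simplexMeasure (Fin.tail y) =
      ∫ x, ((x - a) * (-φ x + (b - x) * deriv φ x) + (d + 1) * ((b - x) * φ x))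
        ∂simplexMeasure y := by
    rw [integral_add (hI (by fun_prop)) (hI (by fun_prop)), h2, integral_const_mul]; ring
  rw [e1, e2, ← integral_add (hI (by fun_prop)) (hI (by fun_prop)), ← integral_const_mul]
  congr 1
  ext x
  ring

/-! ### Total mass and distribution functions -/

theorem measureReal_simplexMeasure_univ {d : ℕ} (y : Fin (d + 1) → ℝ) :
    (simplexMeasure y).real Set.univ = 1 / d.factorial := by
  induction d with
  | zero =>
    have : orderSimplex 0 = Set.univ := by
      ext u; simp [orderSimplex, Antitone]
    rw [simplexMeasure, map_measureReal_apply (continuous_pathSum y).measurable MeasurableSet.univ]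
    simp [this, Measure.real, volume_pi]
  | succ d ih =>
    have h := integral_simplexMeasure_succ y (φ := fun _ => 1) continuous_const
    simp only [integral_const, smul_eq_mul, mul_one, integral_pow, one_pow, ne_eq, zero_pow,
      Nat.add_one_ne_zero, not_false_eq_true, sub_zero, ih] at h
    rw [h, Nat.factorial_succ]
    push_cast
    rw [one_div_mul_one_div, mul_comm]

/-- Abel summation turns the expression into a combination of the z i with nonnegative coefficients
c - u 0, u 0 - u 1, and so on. The constant c replaces 1 because the induction passes to the bound u
0. -/
theorem nonneg_of_antitone_weights {d : ℕ} {z : Fin (d + 1) → ℝ} (hz : ∀ i, 0 ≤ z i)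
    {u : Fin d → ℝ} (hu : Antitone u) (hu0 : ∀ i, 0 ≤ u i) {c : ℝ} (hc : 0 ≤ c)
    (huc : ∀ i, u i ≤ c) : 0 ≤ c * z 0 + ∑ i, u i * (z i.succ - z i.castSucc) := by
  induction d generalizing c with
  | zero => simpa using mul_nonneg hc (hz 0)
  | succ d ih =>
    have h := ih (z := Fin.tail z) (u := Fin.tail u) (fun i => hz _)
      (fun i j hij => hu (Fin.succ_le_succ_iff.2 hij)) (fun i => hu0 _) (hu0 0)
      (fun i => hu (Fin.zero_le _))
    have h1 := mul_nonneg (sub_nonneg.2 (huc 0)) (hz 0)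
    rw [Fin.sum_univ_succ]
    simp only [Fin.tail, Fin.succ_castSucc] at h
    simp only [Fin.castSucc_zero, Fin.succ_zero_eq_one] at h ⊢
    linarith

theorem pathSum_mono {d : ℕ} {y y' : Fin (d + 1) → ℝ} (h : y ≤ y') {u : Fin d → ℝ}
    (hu : u ∈ orderSimplex d) : pathSum y u ≤ pathSum y' u := by
  have := nonneg_of_antitone_weights (z := y' - y) (fun i => sub_nonneg.2 (h i)) hu.1
    (fun i => (hu.2 i).1) zero_le_one (fun i => (hu.2 i).2)
  simp only [Pi.sub_apply] at this
  have h2 : ∑ i, u i * (y' i.succ - y i.succ - (y' i.castSucc - y i.castSucc)) =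
      ∑ i, u i * (y' i.succ - y' i.castSucc) - ∑ i, u i * (y i.succ - y i.castSucc) := by
    rw [← Finset.sum_sub_distrib]
    exact Finset.sum_congr rfl fun i _ => by ring
  rw [h2] at this
  simp only [pathSum, smul_eq_mul]
  linarith

@[simp]
theorem pathSum_const {d : ℕ} (c : ℝ) (u : Fin d → ℝ) :
    pathSum (fun _ : Fin (d + 1) => c) u = c := by
  simp [pathSum]

theorem simplexMeasure_real_Iic {d : ℕ} (y : Fin (d + 1) → ℝ) (s : ℝ) :
    (simplexMeasure y).real (Set.Iic s) =
      (volume.restrict (orderSimplex d)).real {u | pathSum y u ≤ s} := by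
  rw [simplexMeasure, map_measureReal_apply (continuous_pathSum y).measurable measurableSet_Iic]
  rfl

/-- Moving vertices to the right moves mass to the right. This gives the sign of `simplexDensity`
and, by comparison with constant families, the values of the distribution function beyond the knots.
-/
theorem simplexMeasure_real_Iic_anti {d : ℕ} {y y' : Fin (d + 1) → ℝ} (h : y ≤ y') (s : ℝ) :
    (simplexMeasure y').real (Set.Iic s) ≤ (simplexMeasure y).real (Set.Iic s) := by
  rw [simplexMeasure_real_Iic, simplexMeasure_real_Iic]
  refine ENNReal.toReal_mono (measure_ne_top _ _) (measure_mono_ae ?_)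
  filter_upwards [ae_restrict_mem (measurableSet_orderSimplex d)] with u hu
  exact fun h1 => (pathSum_mono h hu).trans h1

/-- The power `(s - t)₊ ^ k`, right-continuous also for `k = 0`. -/
noncomputable def truncPow (k : ℕ) (t s : ℝ) : ℝ := if t ≤ s then (s - t) ^ k else 0

theorem simplexMeasure_real_Iic_const {d : ℕ} (c s : ℝ) :
    (simplexMeasure fun _ : Fin (d + 1) => c).real (Set.Iic s) =
      1 / d.factorial * truncPow 0 c s := by
  rw [simplexMeasure_real_Iic]
  have h := measureReal_simplexMeasure_univ (fun _ : Fin (d + 1) => c)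
  rw [simplexMeasure, map_measureReal_apply (continuous_pathSum _).measurable
    MeasurableSet.univ] at h
  by_cases hcs : c ≤ s
  · simpa [hcs, truncPow] using h
  · simp [hcs, truncPow]

theorem simplexMeasure_real_Iic_of_lt {d : ℕ} {y : Fin (d + 1) → ℝ} {a s : ℝ}
    (h : ∀ i, a ≤ y i) (hs : s < a) : (simplexMeasure y).real (Set.Iic s) = 0 := by
  refine le_antisymm ?_ measureReal_nonneg
  refine (simplexMeasure_real_Iic_anti (y := fun _ => a) h s).trans_eq ?_
  rw [simplexMeasure_real_Iic_const, truncPow, if_neg hs.not_ge, mul_zero]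

theorem simplexMeasure_real_Iic_of_le {d : ℕ} {y : Fin (d + 1) → ℝ} {b s : ℝ}
    (h : ∀ i, y i ≤ b) (hs : b ≤ s) :
    (simplexMeasure y).real (Set.Iic s) = 1 / d.factorial := by
  refine le_antisymm ?_ ?_
  · rw [← measureReal_simplexMeasure_univ y]
    exact measureReal_mono (Set.subset_univ _)
  · refine le_trans ?_ (simplexMeasure_real_Iic_anti (y' := fun _ => b) h s)
    rw [simplexMeasure_real_Iic_const, truncPow, if_pos hs, pow_zero, mul_one]

theorem ae_mem_Icc_simplexMeasure {d : ℕ} {y : Fin (d + 1) → ℝ} {a b : ℝ}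
    (ha : ∀ i, a ≤ y i) (hb : ∀ i, y i ≤ b) : ∀ᵐ x ∂simplexMeasure y, x ∈ Set.Icc a b := by
  rw [simplexMeasure, ae_map_iff (p := fun x => x ∈ Set.Icc a b)
    (continuous_pathSum y).aemeasurable measurableSet_Icc]
  filter_upwards [ae_restrict_mem (measurableSet_orderSimplex d)] with u hu
  constructor
  · simpa using pathSum_mono (y := fun _ => a) ha hu
  · simpa using pathSum_mono (y' := fun _ => b) hb hu

/-! ### The density of a simplex measure -/

/-- The density of `simplexMeasure y`. -/
noncomputable def simplexDensity {d : ℕ} (y : Fin (d + 2) → ℝ) (s : ℝ) : ℝ :=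
  ((simplexMeasure (Fin.init y)).real (Set.Iic s) -
    (simplexMeasure (Fin.tail y)).real (Set.Iic s)) / (y (Fin.last (d + 1)) - y 0)

theorem simplexDensity_nonneg {d : ℕ} {y : Fin (d + 2) → ℝ} (hy : Monotone y) (s : ℝ) :
    0 ≤ simplexDensity y s := by
  refine div_nonneg (sub_nonneg.2 (simplexMeasure_real_Iic_anti (fun i => ?_) s))
    (sub_nonneg.2 (hy (Fin.zero_le _)))
  exact hy (Fin.castSucc_le_succ i)

theorem simplexDensity_eq_zero {d : ℕ} {y : Fin (d + 2) → ℝ} (hy : Monotone y) {s : ℝ}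
    (hs : s ∉ Set.Icc (y 0) (y (Fin.last (d + 1)))) : simplexDensity y s = 0 := by
  have h0 : ∀ i, y 0 ≤ y i := fun i => hy (Fin.zero_le i)
  have h1 : ∀ i, y i ≤ y (Fin.last (d + 1)) := fun i => hy (Fin.le_last i)
  rw [simplexDensity]
  by_cases hs0 : s < y 0
  · rw [simplexMeasure_real_Iic_of_lt (y := Fin.init y) (fun i => h0 _) hs0,
      simplexMeasure_real_Iic_of_lt (y := Fin.tail y) (fun i => h0 _) hs0, sub_zero, zero_div]
  · have hs1 : y (Fin.last (d + 1)) ≤ s := by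
      by_contra h
      exact hs ⟨not_lt.1 hs0, (not_le.1 h).le⟩
    rw [simplexMeasure_real_Iic_of_le (y := Fin.init y) (fun i => h1 _) hs1,
      simplexMeasure_real_Iic_of_le (y := Fin.tail y) (fun i => h1 _) hs1, sub_self, zero_div]

theorem measurable_measureReal_Iic (μ : Measure ℝ) [IsFiniteMeasure μ] :
    Measurable fun s : ℝ => μ.real (Set.Iic s) :=
  Monotone.measurable fun _ _ h => measureReal_mono (Set.Iic_subset_Iic.2 h)

theorem measurable_simplexDensity {d : ℕ} (y : Fin (d + 2) → ℝ) :
    Measurable (simplexDensity y) :=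
  ((measurable_measureReal_Iic _).sub (measurable_measureReal_Iic _)).div_const _

theorem integrable_mul_simplexDensity {d : ℕ} {y : Fin (d + 2) → ℝ} (hy : Monotone y)
    {ψ : ℝ → ℝ} (hψ : Continuous ψ) : Integrable fun s => ψ s * simplexDensity y s := by
  have hb : ∀ s, ‖simplexDensity y s‖ ≤
      1 / d.factorial / (y (Fin.last (d + 1)) - y 0) := by
    intro s
    rw [Real.norm_of_nonneg (simplexDensity_nonneg hy s), simplexDensity]
    refine div_le_div_of_nonneg_right ?_ (sub_nonneg.2 (hy (Fin.zero_le _)))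
    have := measureReal_nonneg (μ := simplexMeasure (Fin.tail y)) (s := Set.Iic s)
    have h2 : (simplexMeasure (Fin.init y)).real (Set.Iic s) ≤ 1 / d.factorial := by
      rw [← measureReal_simplexMeasure_univ (Fin.init y)]
      exact measureReal_mono (Set.subset_univ _)
    linarith
  have h1 : IntegrableOn (fun s => ψ s * simplexDensity y s)
      (Set.Icc (y 0) (y (Fin.last (d + 1)))) :=
    (hψ.integrableOn_Icc).mul_bdd (measurable_simplexDensity y).aestronglyMeasurable
      (ae_of_all _ hb)
  refine (integrableOn_iff_integrable_of_support_subset ?_).1 h1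
  intro s hs
  by_contra h
  exact hs (by simp [simplexDensity_eq_zero hy h])

/-- Fubini on the region x ≤ s. Starting the primitive at the right endpoint b leaves no boundary
term. -/
theorem integral_primitive_eq_neg_integral_measureReal_Iic {μ : Measure ℝ} [IsFiniteMeasure μ]
    {a b : ℝ} (hμ : ∀ᵐ x ∂μ, x ∈ Set.Icc a b) {ψ : ℝ → ℝ} (hψ : Continuous ψ) :
    ∫ x, (∫ s in b..x, ψ s) ∂μ = -∫ s in Set.Icc a b, ψ s * μ.real (Set.Iic s) := by
  have h1 : ∀ᵐ x ∂μ, (∫ s in b..x, ψ s) =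
      -∫ s in Set.Icc a b, (Set.Ici x).indicator ψ s := by
    filter_upwards [hμ] with x hx
    rw [intervalIntegral.integral_symm, intervalIntegral.integral_of_le hx.2,
      ← integral_Icc_eq_integral_Ioc, setIntegral_indicator measurableSet_Ici]
    congr 3
    ext s
    exact ⟨fun h => ⟨⟨hx.1.trans h.1, h.2⟩, h.1⟩, fun h => ⟨h.2, h.1.2⟩⟩
  rw [integral_congr_ae h1, integral_neg, integral_integral_swap]
  · congr 1
    refine integral_congr_ae (ae_of_all _ fun s => ?_)
    have : (fun x => (Set.Ici x).indicator ψ s) = (Set.Iic s).indicator fun _ => ψ s := by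
      ext x; simp [Set.indicator_apply]
    simp only [this]
    rw [integral_indicator measurableSet_Iic, setIntegral_const, smul_eq_mul, mul_comm]
  · have hm : MeasurableSet {p : ℝ × ℝ | p.1 ≤ p.2} :=
      (isClosed_le continuous_fst continuous_snd).measurableSet
    have : Function.uncurry (fun x s => (Set.Ici x).indicator ψ s) =
        {p : ℝ × ℝ | p.1 ≤ p.2}.indicator fun p => ψ p.2 := by
      ext p; simp [Set.indicator_apply, Function.uncurry]
    rw [this]
    refine Integrable.indicator ?_ hm
    exact (hψ.integrableOn_Icc (a := a) (b := b)).comp_snd μ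

/-- The derivative rule is applied to a primitive of ψ, and Fubini turns the two face integrals into
distribution functions. -/
theorem integral_simplexMeasure_eq_integral_density {d : ℕ} {y : Fin (d + 2) → ℝ}
    (hy : Monotone y) (hne : y 0 < y (Fin.last (d + 1))) {ψ : ℝ → ℝ} (hψ : Continuous ψ) :
    ∫ x, ψ x ∂simplexMeasure y = ∫ s, ψ s * simplexDensity y s := by
  have h0 : ∀ i, y 0 ≤ y i := fun i => hy (Fin.zero_le i)
  have h1 : ∀ i, y i ≤ y (Fin.last (d + 1)) := fun i => hy (Fin.le_last i)
  set a := y 0 with ha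
  set b := y (Fin.last (d + 1)) with hb
  have hD : ∀ x, HasDerivAt (fun x => ∫ s in b..x, ψ s) (ψ x) x := fun x =>
    intervalIntegral.integral_hasDerivAt_right (hψ.intervalIntegrable _ _)
      (hψ.stronglyMeasurableAtFilter _ _) hψ.continuousAt
  have hφ : ContDiff ℝ 1 fun x => ∫ s in b..x, ψ s := by
    rw [contDiff_one_iff_deriv]
    refine ⟨fun x => (hD x).differentiableAt, ?_⟩
    rw [funext fun x => (hD x).deriv]
    exact hψ
  have key := mul_integral_deriv_simplexMeasure y hφ
  rw [funext fun x => (hD x).deriv,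
    integral_primitive_eq_neg_integral_measureReal_Iic
      (ae_mem_Icc_simplexMeasure (y := Fin.tail y) (fun i => h0 _) fun i => h1 _) hψ,
    integral_primitive_eq_neg_integral_measureReal_Iic
      (ae_mem_Icc_simplexMeasure (y := Fin.init y) (fun i => h0 _) fun i => h1 _) hψ,
    neg_sub_neg] at key
  have hint : ∀ (μ : Measure ℝ) [IsFiniteMeasure μ],
      IntegrableOn (fun s => ψ s * μ.real (Set.Iic s)) (Set.Icc a b) := fun μ _ =>
    hψ.integrableOn_Icc.mul_bdd (c := μ.real Set.univ)
      (measurable_measureReal_Iic μ).aestronglyMeasurable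
      (ae_of_all _ fun s => by
        rw [Real.norm_of_nonneg measureReal_nonneg]
        exact measureReal_mono (Set.subset_univ _))
  rw [← integral_sub (hint _) (hint _)] at key
  have hsupp : ∫ s, ψ s * simplexDensity y s =
      ∫ s in Set.Icc a b, ψ s * simplexDensity y s := by
    refine (setIntegral_eq_integral_of_forall_compl_eq_zero fun s hs => ?_).symm
    rw [simplexDensity_eq_zero hy hs, mul_zero]
  have hba : b - a ≠ 0 := (sub_pos.2 hne).ne'
  rw [hsupp]
  refine mul_left_cancel₀ hba (key.trans ?_)
  rw [← integral_const_mul]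
  refine integral_congr_ae (ae_of_all _ fun s => ?_)
  simp only [simplexDensity, ← ha, ← hb]
  field_simp

theorem withDensity_ofReal_eq_of_integral_eq {μ : Measure ℝ} [IsFiniteMeasure μ] {ρ : ℝ → ℝ}
    (hρ : ∀ s, 0 ≤ ρ s) (hint : Integrable ρ)
    (h : ∀ ψ : ℝ → ℝ, Continuous ψ → ∫ x, ψ x ∂μ = ∫ s, ψ s * ρ s) :
    μ = volume.withDensity fun s => ENNReal.ofReal (ρ s) := by
  have := isFiniteMeasure_withDensity_ofReal hint.2
  refine ext_of_forall_integral_eq_of_IsFiniteMeasure fun ψ => ?_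
  rw [h ψ ψ.continuous, integral_withDensity_eq_integral_toReal_smul₀
    hint.aestronglyMeasurable.aemeasurable.ennreal_ofReal (ae_of_all _ fun _ => ENNReal.ofReal_lt_top)]
  refine integral_congr_ae (ae_of_all _ fun s => ?_)
  simp [ENNReal.toReal_ofReal (hρ s), mul_comm]

theorem simplexMeasure_real_Iic_eq_integral {d : ℕ} {y : Fin (d + 2) → ℝ}
    (hy : Monotone y) (hne : y 0 < y (Fin.last (d + 1))) (s : ℝ) :
    (simplexMeasure y).real (Set.Iic s) = ∫ x in Set.Iic s, simplexDensity y x := by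
  have hint : Integrable (simplexDensity y) := by
    simpa using integrable_mul_simplexDensity hy (ψ := fun _ => 1) continuous_const
  rw [withDensity_ofReal_eq_of_integral_eq (simplexDensity_nonneg hy) hint
    fun ψ hψ => integral_simplexMeasure_eq_integral_density hy hne hψ, Measure.real,
    withDensity_apply _ measurableSet_Iic,
    ← ofReal_integral_eq_lintegral_ofReal hint.integrableOn
      (ae_of_all _ (simplexDensity_nonneg hy)),
    ENNReal.toReal_ofReal (integral_nonneg (simplexDensity_nonneg hy))]

/-! ### Knot multiplicities and truncated powers -/

theorem knotMultiplicity_comp_le {k n : ℕ} (x : Fin n → ℝ) {e : Fin k → Fin n}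
    (he : Function.Injective e) (t : ℝ) : knotMultiplicity (x ∘ e) t ≤ knotMultiplicity x t := by
  rw [knotMultiplicity, knotMultiplicity, ← Set.ncard_image_of_injective _ he]
  refine Set.ncard_le_ncard ?_ (Set.toFinite _)
  rintro _ ⟨i, hi, rfl⟩
  exact hi

theorem knotMultiplicity_pos_iff {n : ℕ} {x : Fin n → ℝ} {t : ℝ} :
    0 < knotMultiplicity x t ↔ t ∈ Set.range x := by
  rw [knotMultiplicity, Set.ncard_pos]; rfl

theorem knotMultiplicity_le_one {n : ℕ} {x : Fin n → ℝ} (hx : Function.Injective x) (t : ℝ) :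
    knotMultiplicity x t ≤ 1 := by
  rw [knotMultiplicity, Set.ncard_le_one]
  exact fun a ha b hb => hx (ha.trans hb.symm)

/-- The span of the truncated powers `(s - t)₊ ^ (k - j)` with `j < m t` and `j ≤ k`. -/
noncomputable def truncSpan (k : ℕ) (m : ℝ → ℕ) : Submodule ℝ (ℝ → ℝ) :=
  Submodule.span ℝ {f | ∃ t j, j < m t ∧ j ≤ k ∧ f = truncPow (k - j) t}

theorem truncSpan_mono {k : ℕ} {m m' : ℝ → ℕ} (h : ∀ t, m t ≤ m' t) :
    truncSpan k m ≤ truncSpan k m' := by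
  refine Submodule.span_mono ?_
  rintro f ⟨t, j, hj, hjk, rfl⟩
  exact ⟨t, j, hj.trans_le (h t), hjk, rfl⟩

theorem truncPow_eq_indicator (k : ℕ) (t : ℝ) :
    truncPow k t = (Set.Ici t).indicator fun s => (s - t) ^ k := by
  ext s; simp [truncPow, Set.indicator_apply]

theorem integrableOn_truncPow (k : ℕ) (t s : ℝ) : IntegrableOn (truncPow k t) (Set.Iic s) := by
  rw [truncPow_eq_indicator, IntegrableOn, integrable_indicator_iff measurableSet_Ici,
    IntegrableOn, Measure.restrict_restrict measurableSet_Ici, Set.Ici_inter_Iic]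
  exact Continuous.integrableOn_Icc (by fun_prop)

theorem integral_Iic_truncPow (k : ℕ) (t s : ℝ) :
    ∫ x in Set.Iic s, truncPow k t x = (k + 1 : ℝ)⁻¹ * truncPow (k + 1) t s := by
  rw [truncPow_eq_indicator, integral_indicator measurableSet_Ici,
    Measure.restrict_restrict measurableSet_Ici, Set.Ici_inter_Iic, truncPow]
  split_ifs with h
  · rw [integral_Icc_eq_integral_Ioc, ← intervalIntegral.integral_of_le h,
      intervalIntegral.integral_comp_sub_right (fun x => x ^ k), integral_pow]
    simp [div_eq_inv_mul]
  · simp [Set.Icc_eq_empty h]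

/-- Integration from -∞ raises the exponent k - j by one through k and keeps j, so the multiplicity
bound is unaffected. -/
theorem integrableOn_and_integral_mem_truncSpan {k : ℕ} {m : ℝ → ℕ} {f : ℝ → ℝ}
    (hf : f ∈ truncSpan k m) : (∀ s, IntegrableOn f (Set.Iic s)) ∧
      (fun s => ∫ x in Set.Iic s, f x) ∈ truncSpan (k + 1) m := by
  induction hf using Submodule.span_induction with
  | mem f hf =>
    obtain ⟨t, j, hj, hjk, rfl⟩ := hf
    refine ⟨integrableOn_truncPow _ _, ?_⟩
    simp_rw [integral_Iic_truncPow]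
    refine Submodule.smul_mem _ _ (Submodule.subset_span ⟨t, j, hj, by omega, ?_⟩)
    rw [Nat.sub_add_comm hjk]
  | zero =>
    refine ⟨fun s => integrableOn_zero, ?_⟩
    convert Submodule.zero_mem (truncSpan (k + 1) m)
    simp
  | add f g _ _ hf hg =>
    refine ⟨fun s => (hf.1 s).add (hg.1 s), ?_⟩
    have : (fun s => ∫ x in Set.Iic s, (f + g) x) =
        (fun s => ∫ x in Set.Iic s, f x) + fun s => ∫ x in Set.Iic s, g x :=
      funext fun s => integral_add (hf.1 s) (hg.1 s)
    rw [this]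
    exact add_mem hf.2 hg.2
  | smul c f _ hf =>
    refine ⟨fun s => (hf.1 s).smul c, ?_⟩
    have : (fun s => ∫ x in Set.Iic s, (c • f) x) = c • fun s => ∫ x in Set.Iic s, f x :=
      funext fun s => integral_smul c f
    rw [this]
    exact Submodule.smul_mem _ _ hf.2

theorem monotone_eq_const {d : ℕ} {y : Fin (d + 1) → ℝ} (hy : Monotone y)
    (h : y (Fin.last d) ≤ y 0) : y = fun _ => y 0 :=
  funext fun i => le_antisymm ((hy (Fin.le_last i)).trans h) (hy (Fin.zero_le i))

theorem knotMultiplicity_init_le {d : ℕ} (y : Fin (d + 2) → ℝ) (t : ℝ) :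
    knotMultiplicity (Fin.init y) t ≤ knotMultiplicity y t :=
  knotMultiplicity_comp_le y (Fin.castSucc_injective _) t

theorem knotMultiplicity_tail_le {d : ℕ} (y : Fin (d + 2) → ℝ) (t : ℝ) :
    knotMultiplicity (Fin.tail y) t ≤ knotMultiplicity y t :=
  knotMultiplicity_comp_le y (Fin.succ_injective _) t

theorem Monotone.fin_init {d : ℕ} {y : Fin (d + 1) → ℝ} (hy : Monotone y) :
    Monotone (Fin.init y) := fun _ _ h => hy (Fin.castSucc_le_castSucc_iff.2 h)

theorem Monotone.fin_tail {d : ℕ} {y : Fin (d + 1) → ℝ} (hy : Monotone y) :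
    Monotone (Fin.tail y) := fun _ _ h => hy (Fin.succ_le_succ_iff.2 h)

theorem simplexDensity_mem_truncSpan_of {d : ℕ} {y : Fin (d + 2) → ℝ}
    (h1 : (fun s => (simplexMeasure (Fin.init y)).real (Set.Iic s)) ∈
      truncSpan d (knotMultiplicity (Fin.init y)))
    (h2 : (fun s => (simplexMeasure (Fin.tail y)).real (Set.Iic s)) ∈
      truncSpan d (knotMultiplicity (Fin.tail y))) :
    simplexDensity y ∈ truncSpan d (knotMultiplicity y) := by
  have h := Submodule.smul_mem _ (y (Fin.last (d + 1)) - y 0)⁻¹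
    (sub_mem (truncSpan_mono (knotMultiplicity_init_le y) h1)
      (truncSpan_mono (knotMultiplicity_tail_le y) h2))
  convert h using 1
  ext s
  simp [simplexDensity, div_eq_inv_mul]

theorem simplexMeasure_real_Iic_mem_truncSpan {d : ℕ} {y : Fin (d + 1) → ℝ} (hy : Monotone y) :
    (fun s => (simplexMeasure y).real (Set.Iic s)) ∈ truncSpan d (knotMultiplicity y) := by
  induction d with
  | zero =>
    obtain ⟨c, rfl⟩ : ∃ c, y = fun _ => c := ⟨y 0, funext fun i => by rw [Fin.fin_one_eq_zero i]⟩
    simp_rw [simplexMeasure_real_Iic_const]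
    refine Submodule.smul_mem _ _ (Submodule.subset_span ⟨c, 0, ?_, le_rfl, rfl⟩)
    exact knotMultiplicity_pos_iff.2 ⟨0, rfl⟩
  | succ d ih =>
    rcases lt_or_ge (y 0) (y (Fin.last (d + 1))) with hne | hc
    · simp_rw [simplexMeasure_real_Iic_eq_integral hy hne]
      exact (integrableOn_and_integral_mem_truncSpan
        (simplexDensity_mem_truncSpan_of (ih hy.fin_init) (ih hy.fin_tail))).2
    -- All d + 2 knots coincide: the distribution function is a multiple of a Heaviside step, the
    -- truncated power with j = d + 1, the largest j the multiplicity allows.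
    · rw [monotone_eq_const hy hc]
      simp_rw [simplexMeasure_real_Iic_const]
      refine Submodule.smul_mem _ _ (Submodule.subset_span ⟨y 0, d + 1, ?_, le_rfl, by simp⟩)
      simp [knotMultiplicity, Set.ncard_univ]

theorem simplexDensity_mem_truncSpan {d : ℕ} {y : Fin (d + 2) → ℝ} (hy : Monotone y) :
    simplexDensity y ∈ truncSpan d (knotMultiplicity y) :=
  simplexDensity_mem_truncSpan_of (simplexMeasure_real_Iic_mem_truncSpan hy.fin_init)
    (simplexMeasure_real_Iic_mem_truncSpan hy.fin_tail)

theorem isPiecewisePolynomial_of_mem_truncSpan {k : ℕ} {m : ℝ → ℕ} {K : Set ℝ}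
    (hK : ∀ t, 0 < m t → t ∈ K) {f : ℝ → ℝ} (hf : f ∈ truncSpan k m) :
    IsPiecewisePolynomial k K f := by
  intro I hI hIK
  induction hf using Submodule.span_induction with
  | mem f hf =>
    obtain ⟨t, j, hj, hjk, rfl⟩ := hf
    have htI : t ∉ I := fun h => Set.disjoint_left.1 hIK h (hK t (by omega))
    by_cases h : ∃ s ∈ I, t ≤ s
    · obtain ⟨s, hs, hts⟩ := h
      refine ⟨(Polynomial.X - Polynomial.C t) ^ (k - j), ?_, fun r hr => ?_⟩
      · rw [Polynomial.natDegree_pow, Polynomial.natDegree_X_sub_C]; omega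
      · have : t ≤ r := by
          by_contra hrt
          exact htI (hI.out hr hs ⟨(not_le.1 hrt).le, hts⟩)
        simp [truncPow, this]
    · push Not at h
      exact ⟨0, by simp, fun r hr => by simp [truncPow, (h r hr).not_ge]⟩
  | zero => exact ⟨0, by simp, by simp⟩
  | add f g _ _ hf hg =>
    obtain ⟨p, hp, hpf⟩ := hf
    obtain ⟨q, hq, hqg⟩ := hg
    exact ⟨p + q, (Polynomial.natDegree_add_le _ _).trans (max_le hp hq), fun t ht => by
      simp [hpf t ht, hqg t ht]⟩
  | smul c f _ hf =>
    obtain ⟨p, hp, hpf⟩ := hf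
    exact ⟨c • p, (Polynomial.natDegree_smul_le _ _).trans hp, fun t ht => by
      simp [hpf t ht]⟩

theorem hasDerivAt_truncPow (k : ℕ) (t s : ℝ) :
    HasDerivAt (truncPow (k + 2) t) ((k + 2 : ℝ) * truncPow (k + 1) t s) s := by
  have hpow : ∀ s : ℝ, HasDerivAt (fun s => (s - t) ^ (k + 2))
      ((k + 2 : ℝ) * (s - t) ^ (k + 1)) s := fun s => by
    have := ((hasDerivAt_id s).sub_const t).fun_pow (k + 2)
    simpa using this
  rcases lt_trichotomy s t with h | rfl | h
  · have : truncPow (k + 2) t =ᶠ[nhds s] fun _ => 0 := by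
      filter_upwards [Iio_mem_nhds h] with r hr
      simp [truncPow, not_le.2 (Set.mem_Iio.1 hr)]
    simpa [truncPow, h.not_ge] using (hasDerivAt_const s (0 : ℝ)).congr_of_eventuallyEq this
  · have h1 : HasDerivWithinAt (truncPow (k + 2) s) ((k + 2 : ℝ) * truncPow (k + 1) s s)
        (Set.Iic s) s := by
      have : Set.EqOn (truncPow (k + 2) s) (fun _ => 0) (Set.Iic s) := fun r hr => by
        rcases (Set.mem_Iic.1 hr).eq_or_lt with rfl | h
        · simp [truncPow]
        · simp [truncPow, h.not_ge]
      simpa [truncPow] using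
        (hasDerivWithinAt_const s (Set.Iic s) (0 : ℝ)).congr this (this (Set.mem_Iic.2 le_rfl))
    have h2 : HasDerivWithinAt (truncPow (k + 2) s) ((k + 2 : ℝ) * truncPow (k + 1) s s)
        (Set.Ici s) s := by
      have : Set.EqOn (truncPow (k + 2) s) (fun r => (r - s) ^ (k + 2)) (Set.Ici s) :=
        fun r hr => by simp [truncPow, Set.mem_Ici.1 hr]
      simpa [truncPow] using
        (hpow s).hasDerivWithinAt.congr this (this (Set.mem_Ici.2 le_rfl))
    have := h1.union h2
    rwa [Set.Iic_union_Ici, hasDerivWithinAt_univ] at this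
  · have : truncPow (k + 2) t =ᶠ[nhds s] fun s => (s - t) ^ (k + 2) := by
      filter_upwards [Ioi_mem_nhds h] with r hr
      simp [truncPow, (Set.mem_Ioi.1 hr).le]
    simpa [truncPow, h.le] using (hpow s).congr_of_eventuallyEq this

theorem contDiff_truncPow (k : ℕ) (t : ℝ) : ContDiff ℝ k (truncPow (k + 1) t) := by
  induction k with
  | zero =>
    rw [Nat.cast_zero, contDiff_zero]
    have : truncPow (0 + 1) t = fun s => max (s - t) 0 := by
      ext s
      by_cases h : t ≤ s
      · simp [truncPow, h]
      · simp [truncPow, h, (not_le.1 h).le]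
    rw [this]; fun_prop
  | succ k ih =>
    rw [Nat.cast_add, Nat.cast_one, contDiff_succ_iff_deriv]
    refine ⟨fun s => (hasDerivAt_truncPow k t s).differentiableAt, by simp, ?_⟩
    rw [funext fun s => (hasDerivAt_truncPow k t s).deriv]
    exact contDiff_const.mul ih

theorem contDiffAt_truncPow_of_ne (k n : ℕ) {t s : ℝ} (h : s ≠ t) :
    ContDiffAt ℝ n (truncPow k t) s := by
  rcases h.lt_or_gt with h | h
  · refine (contDiffAt_const (c := (0 : ℝ))).congr_of_eventuallyEq ?_
    filter_upwards [Iio_mem_nhds h] with r hr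
    simp [truncPow, not_le.2 (Set.mem_Iio.1 hr)]
  · refine ContDiffAt.congr_of_eventuallyEq (f := fun s => (s - t) ^ k) (by fun_prop) ?_
    filter_upwards [Ioi_mem_nhds h] with r hr
    simp [truncPow, (Set.mem_Ioi.1 hr).le]

/-- Only generators centred at t can be singular there, and their exponents k - j exceed n because j
< m t. -/
theorem contDiffAt_of_mem_truncSpan {k n : ℕ} {m : ℝ → ℕ} {f : ℝ → ℝ} (hf : f ∈ truncSpan k m)
    {t : ℝ} (hn : n + m t ≤ k) : ContDiffAt ℝ n f t := by
  induction hf using Submodule.span_induction with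
  | mem f hf =>
    obtain ⟨t', j, hj, hjk, rfl⟩ := hf
    by_cases h : t = t'
    · subst h
      obtain ⟨l, hl⟩ : ∃ l, k - j = l + 1 := ⟨k - j - 1, by omega⟩
      rw [hl]
      exact ((contDiff_truncPow l t).of_le (by exact_mod_cast (by omega : n ≤ l))).contDiffAt
    · exact contDiffAt_truncPow_of_ne _ _ h
  | zero => exact contDiffAt_const (c := (0 : ℝ))
  | add f g _ _ hf hg => exact hf.add hg
  | smul c f _ hf => exact hf.const_smul c

/-! ### Distributional derivatives and Dirac masses -/

theorem distribDeriv_succ (j : ℕ) (T : 𝓓'((⊤ : TopologicalSpace.Opens ℝ), ℝ)) :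
    distribDeriv (j + 1) T = distribDeriv j (∂_{(1 : ℝ)} T) := rfl

theorem distribDeriv_add (j : ℕ) (S T : 𝓓'((⊤ : TopologicalSpace.Opens ℝ), ℝ)) :
    distribDeriv j (S + T) = distribDeriv j S + distribDeriv j T := by
  induction j generalizing S T with
  | zero => rfl
  | succ j ih => rw [distribDeriv_succ, LineDeriv.lineDerivOp_add, ih]; rfl

theorem distribDeriv_smul (j : ℕ) (c : ℝ) (T : 𝓓'((⊤ : TopologicalSpace.Opens ℝ), ℝ)) :
    distribDeriv j (c • T) = c • distribDeriv j T := by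
  induction j generalizing T with
  | zero => rfl
  | succ j ih => rw [distribDeriv_succ, LineDeriv.lineDerivOp_smul, ih]; rfl

/-- The `j`-th distributional derivative as a linear map. -/
noncomputable def distribDerivLM (j : ℕ) :
    𝓓'((⊤ : TopologicalSpace.Opens ℝ), ℝ) →ₗ[ℝ] 𝓓'((⊤ : TopologicalSpace.Opens ℝ), ℝ) where
  toFun := distribDeriv j
  map_add' := distribDeriv_add j
  map_smul' := distribDeriv_smul j

/-- The span of the distributions `D^j δ_t` with `j < m t`. -/
noncomputable def diracSpan (m : ℝ → ℕ) :
    Submodule ℝ 𝓓'((⊤ : TopologicalSpace.Opens ℝ), ℝ) :=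
  Submodule.span ℝ {T | ∃ t j, j < m t ∧ T = distribDeriv j (diracDistribution t)}

theorem diracSpan_mono {m m' : ℝ → ℕ} (h : ∀ t, m t ≤ m' t) : diracSpan m ≤ diracSpan m' := by
  refine Submodule.span_mono ?_
  rintro T ⟨t, j, hj, rfl⟩
  exact ⟨t, j, hj.trans_le (h t), rfl⟩

theorem integral_simplexMeasure_const {d : ℕ} (c : ℝ) (φ : ℝ → ℝ) :
    ∫ x, φ x ∂simplexMeasure (fun _ : Fin (d + 1) => c) = 1 / d.factorial * φ c := by
  have h := measureReal_simplexMeasure_univ (fun _ : Fin (d + 1) => c)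
  have h2 : ∀ᵐ x ∂simplexMeasure (fun _ : Fin (d + 1) => c), φ x = φ c := by
    filter_upwards [ae_mem_Icc_simplexMeasure (y := fun _ : Fin (d + 1) => c)
      (fun _ => le_rfl) (fun _ => le_rfl)] with x hx
    rw [le_antisymm hx.2 hx.1]
  rw [integral_congr_ae h2, integral_const, h, smul_eq_mul]

/-- The dual form of `mul_integral_deriv_simplexMeasure`; the sign of the distributional derivative
exchanges the two faces. -/
theorem lineDerivOp_measureDistribution_simplexMeasure {d : ℕ} (y : Fin (d + 2) → ℝ) :
    (y (Fin.last (d + 1)) - y 0) • (∂_{(1 : ℝ)} (measureDistribution (simplexMeasure y)) :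
      𝓓'((⊤ : TopologicalSpace.Opens ℝ), ℝ)) =
      measureDistribution (simplexMeasure (Fin.init y)) -
        measureDistribution (simplexMeasure (Fin.tail y)) := by
  ext φ
  have hφ : ContDiff ℝ 1 φ := φ.contDiff.of_le (by simp)
  have h := mul_integral_deriv_simplexMeasure y hφ
  have hd : ∀ x, (∂_{(1 : ℝ)} φ : 𝓓((⊤ : TopologicalSpace.Opens ℝ), ℝ)) x = deriv φ x := fun x => by
    rw [TestFunction.lineDerivOp_eq_lineDerivCLM (𝕜 := ℝ),
      TestFunction.lineDerivCLM_apply_of_le (by simp),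
      (hφ.differentiable one_ne_zero x).lineDeriv_eq_fderiv, fderiv_apply_one_eq_deriv]
  change (y (Fin.last (d + 1)) - y 0) * (∂_{(1 : ℝ)} (measureDistribution (simplexMeasure y)) :
      𝓓'((⊤ : TopologicalSpace.Opens ℝ), ℝ)) φ = measureDistribution (simplexMeasure (Fin.init y)) φ -
        measureDistribution (simplexMeasure (Fin.tail y)) φ
  rw [Distribution.lineDerivOp_apply_apply, map_neg, measureDistribution_apply,
    measureDistribution_apply, measureDistribution_apply]
  simp_rw [hd]
  linarith

/-- Each derivative passes to a difference of two face measures. Once all knots of a face coincide,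
its measure is a point mass, and the multiplicity is just large enough for the derivatives still to
be taken. -/
theorem distribDeriv_simplexMeasure_mem_diracSpan {d : ℕ} {y : Fin (d + 1) → ℝ}
    (hy : Monotone y) :
    distribDeriv d (measureDistribution (simplexMeasure y)) ∈ diracSpan (knotMultiplicity y) := by
  have hconst : ∀ (d : ℕ) (c : ℝ),
      distribDeriv d (measureDistribution (simplexMeasure fun _ : Fin (d + 1) => c)) ∈
        diracSpan (knotMultiplicity fun _ : Fin (d + 1) => c) := by
    intro d c
    have : measureDistribution (simplexMeasure fun _ : Fin (d + 1) => c) =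
        (1 / d.factorial : ℝ) • diracDistribution c := by
      ext φ
      rw [measureDistribution_apply, integral_simplexMeasure_const]
      rfl
    rw [this, distribDeriv_smul]
    refine Submodule.smul_mem _ _ (Submodule.subset_span ⟨c, d, ?_, rfl⟩)
    simp [knotMultiplicity, Set.ncard_univ]
  induction d with
  | zero =>
    obtain ⟨c, rfl⟩ : ∃ c, y = fun _ => c := ⟨y 0, funext fun i => by rw [Fin.fin_one_eq_zero i]⟩
    exact hconst 0 c
  | succ d ih =>
    rcases lt_or_ge (y 0) (y (Fin.last (d + 1))) with hne | hc
    · have hba : y (Fin.last (d + 1)) - y 0 ≠ 0 := (sub_pos.2 hne).ne'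
      have h := lineDerivOp_measureDistribution_simplexMeasure y
      rw [← eq_inv_smul_iff₀ hba] at h
      rw [distribDeriv_succ, h, distribDeriv_smul]
      refine Submodule.smul_mem _ _ ?_
      change distribDerivLM d _ ∈ _
      rw [map_sub]
      exact sub_mem (diracSpan_mono (knotMultiplicity_init_le y) (ih hy.fin_init))
        (diracSpan_mono (knotMultiplicity_tail_le y) (ih hy.fin_tail))
    · rw [monotone_eq_const hy hc]
      exact hconst (d + 1) (y 0)

theorem exists_coeff_of_mem_diracSpan {n : ℕ} {x : Fin n → ℝ}
    {T : 𝓓'((⊤ : TopologicalSpace.Opens ℝ), ℝ)} (hT : T ∈ diracSpan (knotMultiplicity x)) :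
    ∃ c : ℝ → ℕ → ℝ, T = ∑ t ∈ Finset.univ.image x, ∑ j ∈ Finset.range (knotMultiplicity x t),
      c t j • distribDeriv j (diracDistribution t) := by
  induction hT using Submodule.span_induction with
  | mem T hT =>
    obtain ⟨t, j, hj, rfl⟩ := hT
    refine ⟨fun t' j' => if t' = t then (if j' = j then 1 else 0) else 0, ?_⟩
    have ht : t ∈ Finset.univ.image x := by
      simpa using knotMultiplicity_pos_iff.1 ((Nat.zero_le j).trans_lt hj)
    rw [Finset.sum_eq_single_of_mem t ht (fun t' _ h => Finset.sum_eq_zero fun j' _ => by simp [h]),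
      Finset.sum_eq_single_of_mem j (Finset.mem_range.2 hj) (fun j' _ h => by simp [h])]
    simp
  | zero => exact ⟨0, by simp⟩
  | add S T _ _ hS hT =>
    obtain ⟨c, hc⟩ := hS
    obtain ⟨c', hc'⟩ := hT
    refine ⟨c + c', ?_⟩
    conv_lhs => rw [hc, hc']
    simp only [Pi.add_apply, add_smul, Finset.sum_add_distrib]
  | smul a T _ hT =>
    obtain ⟨c, hc⟩ := hT
    refine ⟨a • c, ?_⟩
    conv_lhs => rw [hc]
    simp only [Pi.smul_apply, smul_assoc, Finset.smul_sum]

theorem exists_coeff_of_mem_diracSpan_of_injective {n : ℕ} {x : Fin n → ℝ}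
    (hx : Function.Injective x) {T : 𝓓'((⊤ : TopologicalSpace.Opens ℝ), ℝ)}
    (hT : T ∈ diracSpan (knotMultiplicity x)) :
    ∃ c : Fin n → ℝ, T = ∑ i, c i • diracDistribution (x i) := by
  obtain ⟨c, hc⟩ := exists_coeff_of_mem_diracSpan hT
  refine ⟨fun i => c (x i) 0, ?_⟩
  rw [hc, Finset.sum_image hx.injOn]
  refine Finset.sum_congr rfl fun i _ => ?_
  have : knotMultiplicity x (x i) = 1 :=
    le_antisymm (knotMultiplicity_le_one hx _) (knotMultiplicity_pos_iff.2 ⟨i, rfl⟩)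
  rw [this, Finset.sum_range_one]
  rfl

/-! ### Identification with B-splines -/

/-- Both sides obey the same recursion: Cox–de Boor on the left, `integral_simplexMeasure_recursion`
on the right. Integrability is carried along so that the recursion can be integrated term by term.
-/
theorem bspline_integral {d : ℕ} {y : Fin (d + 2) → ℝ} (hy : Monotone y) :
    (∀ φ : ℝ → ℝ, Continuous φ → Integrable fun t => φ t * bspline (d + 1) y t) ∧
    ∀ φ : ℝ → ℝ, ContDiff ℝ 1 φ → ∫ t, φ t * bspline (d + 1) y t =
      d.factorial * (y (Fin.last (d + 1)) - y 0) * ∫ x, φ x ∂simplexMeasure y := by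
  induction d with
  | zero =>
    have h01 : y 0 ≤ y 1 := hy (Fin.zero_le 1)
    have hb : ∀ φ : ℝ → ℝ, (fun t => φ t * bspline 1 y t) = (Set.Ico (y 0) (y 1)).indicator φ := by
      intro φ; ext t
      by_cases h : t ∈ Set.Ico (y 0) (y 1) <;> simp [bspline, h]
    simp only [hb]
    refine ⟨fun φ hφ => ?_, fun φ hφ => ?_⟩
    · rw [integrable_indicator_iff measurableSet_Ico]
      exact hφ.integrableOn_Icc.mono_set Set.Ico_subset_Icc_self
    · have hD : ∀ x, HasDerivAt (fun x => ∫ s in (0 : ℝ)..x, φ s) (φ x) x := fun x =>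
        intervalIntegral.integral_hasDerivAt_right (hφ.continuous.intervalIntegrable _ _)
          (hφ.continuous.stronglyMeasurableAtFilter _ _) hφ.continuous.continuousAt
      have hΦ : ContDiff ℝ 1 fun x => ∫ s in (0 : ℝ)..x, φ s := by
        rw [contDiff_one_iff_deriv, funext fun x => (hD x).deriv]
        exact ⟨fun x => (hD x).differentiableAt, hφ.continuous⟩
      have key := mul_integral_deriv_simplexMeasure y hΦ
      have e1 : Fin.tail y = fun _ => y 1 := funext fun i => by rw [Fin.fin_one_eq_zero i]; rfl
      have e2 : Fin.init y = fun _ => y 0 := funext fun i => by rw [Fin.fin_one_eq_zero i]; rfl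
      rw [funext fun x => (hD x).deriv, e1, e2, integral_simplexMeasure_const,
        integral_simplexMeasure_const] at key
      rw [integral_indicator measurableSet_Ico, integral_Ico_eq_integral_Ioc,
        ← intervalIntegral.integral_of_le h01, Nat.factorial_zero, Nat.cast_one, one_mul, key,
        ← intervalIntegral.integral_interval_sub_left (a := 0) (hφ.continuous.intervalIntegrable _ _)
          (hφ.continuous.intervalIntegrable _ _)]
      simp
  | succ d ih =>
    obtain ⟨ii, hi⟩ := ih hy.fin_init
    obtain ⟨ti, ht⟩ := ih hy.fin_tail
    have hI : (Fin.init y) (Fin.last (d + 1)) - Fin.init y 0 =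
      y (Fin.last (d + 1)).castSucc - y 0 := rfl
    have hT : (Fin.tail y) (Fin.last (d + 1)) - Fin.tail y 0 = y (Fin.last (d + 2)) - y 1 := rfl
    have hrec : ∀ (φ : ℝ → ℝ), (fun t => φ t * bspline (d + 1 + 1) y t) = fun t =>
        (y (Fin.last (d + 1)).castSucc - y 0)⁻¹ *
          (((t - y 0) * φ t) * bspline (d + 1) (Fin.init y) t) +
        (y (Fin.last (d + 2)) - y 1)⁻¹ *
          (((y (Fin.last (d + 2)) - t) * φ t) * bspline (d + 1) (Fin.tail y) t) := by
      intro φ; ext t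
      simp only [bspline, div_eq_inv_mul]
      unfold Fin.init Fin.tail
      ring
    simp only [hrec]
    refine ⟨fun φ hφ => ((ii _ (by fun_prop)).const_mul _).add ((ti _ (by fun_prop)).const_mul _),
      fun φ hφ => ?_⟩
    have hφc := hφ.continuous
    rw [integral_add ((ii _ (by fun_prop)).const_mul _) ((ti _ (by fun_prop)).const_mul _),
      integral_const_mul, integral_const_mul, hi _ (by fun_prop), ht _ (by fun_prop), hI, hT]
    have key := integral_simplexMeasure_recursion y hφ
    have c1 : (y (Fin.last (d + 1)).castSucc - y 0)⁻¹ *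
        (d.factorial * (y (Fin.last (d + 1)).castSucc - y 0) *
          ∫ x, (x - y 0) * φ x ∂simplexMeasure (Fin.init y)) =
        d.factorial * ∫ x, (x - y 0) * φ x ∂simplexMeasure (Fin.init y) := by
      by_cases h : y (Fin.last (d + 1)).castSucc - y 0 = 0
      -- The convention for vanishing denominators is consistent: here the face measure is a point
      -- mass at y 0, where the factor x - y 0 vanishes.
      · have hc : Fin.init y = fun _ => y 0 :=
          monotone_eq_const hy.fin_init (sub_eq_zero.1 h).le
        rw [hc, integral_simplexMeasure_const]
        simp
      · field_simp
    have c2 : (y (Fin.last (d + 2)) - y 1)⁻¹ *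
        (d.factorial * (y (Fin.last (d + 2)) - y 1) *
          ∫ x, (y (Fin.last (d + 2)) - x) * φ x ∂simplexMeasure (Fin.tail y)) =
        d.factorial * ∫ x, (y (Fin.last (d + 2)) - x) * φ x ∂simplexMeasure (Fin.tail y) := by
      by_cases h : y (Fin.last (d + 2)) - y 1 = 0
      · have hc : Fin.tail y = fun _ => y 1 :=
          monotone_eq_const hy.fin_tail (sub_eq_zero.1 h).le
        rw [hc, integral_simplexMeasure_const, h]
        simp
      · field_simp
    rw [c1, c2, ← mul_add, ← key, Nat.factorial_succ]
    push_cast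
    ring

/-! ### Simplices in ℝ^d and their projections -/

theorem convexHull_range_eq_image_orderSimplex {d : ℕ} {V : Type*} [AddCommGroup V] [Module ℝ V]
    (w : Fin (d + 1) → V) : convexHull ℝ (Set.range w) = pathSum w '' orderSimplex d := by
  induction d with
  | zero =>
    have h1 : Set.range w = {w 0} := by
      ext v
      simp only [Set.mem_range, Set.mem_singleton_iff]
      constructor
      · rintro ⟨i, rfl⟩; rw [Fin.fin_one_eq_zero i]
      · rintro rfl; exact ⟨0, rfl⟩
    have h2 : pathSum w = fun _ => w 0 := by ext u; simp [pathSum]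
    have h3 : (orderSimplex 0).Nonempty := ⟨0, by simp [orderSimplex, Antitone]⟩
    rw [h1, convexHull_singleton, h2, h3.image_const]
  | succ d ih =>
    have h1 : Set.range w = insert (w 0) (Set.range (Fin.tail w)) := by
      ext v
      simp [Fin.exists_fin_succ, Fin.tail, eq_comm]
    rw [h1, convexHull_insert (Set.range_nonempty _), convexJoin_singleton_left, ih]
    ext v
    simp only [Set.mem_iUnion, exists_prop, Set.mem_image, exists_exists_and_eq_and]
    constructor
    · rintro ⟨u, hu, hv⟩
      rw [segment_eq_image'] at hv
      obtain ⟨r, hr, rfl⟩ := hv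
      exact ⟨_, cons_smul_mem_orderSimplex hr.1 hr.2 hu, pathSum_cons w r u⟩
    · rintro ⟨u', hu', rfl⟩
      rw [← Fin.cons_self_tail u'] at hu' ⊢
      obtain ⟨h0, h1, u, hu, h⟩ := exists_of_cons_mem_orderSimplex hu'
      refine ⟨u, hu, ?_⟩
      rw [h, pathSum_cons, segment_eq_image']
      exact ⟨_, ⟨h0, h1⟩, rfl⟩

/-- The linear part of `pathSum w`. -/
def pathLinear {d : ℕ} {V : Type*} [AddCommGroup V] [Module ℝ V] (w : Fin (d + 1) → V) :
    (Fin d → ℝ) →ₗ[ℝ] V where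
  toFun u := ∑ i, u i • (w i.succ - w i.castSucc)
  map_add' u v := by simp [add_smul, Finset.sum_add_distrib]
  map_smul' c u := by simp [mul_smul, Finset.smul_sum]

theorem pathLinear_injective {d : ℕ} {V : Type*} [AddCommGroup V] [Module ℝ V]
    {w : Fin (d + 1) → V} (hw : AffineIndependent ℝ w) : Function.Injective (pathLinear w) := by
  rw [← LinearMap.ker_eq_bot, LinearMap.ker_eq_bot']
  intro u hu
  -- By Abel summation, l k is the coefficient of w k in `pathLinear w u`. The padding zeros make
  -- the l k sum to 0, so affine independence applies; l = 0 then propagates the initial zero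
  -- through u.
  let l : Fin (d + 1) → ℝ := fun k => (Fin.cons 0 u : Fin (d + 1) → ℝ) k -
    (Fin.snoc u 0 : Fin (d + 1) → ℝ) k
  have hl : ∀ k, l k = 0 := by
    refine fun k => (affineIndependent_iff.1 hw) Finset.univ l ?_ ?_ k (Finset.mem_univ k)
    · simp only [l, Finset.sum_sub_distrib]
      rw [Fin.sum_univ_succ, Fin.sum_univ_castSucc]
      simp
    · simp only [l, sub_smul, Finset.sum_sub_distrib]
      rw [Fin.sum_univ_succ, Fin.sum_univ_castSucc (fun k => (Fin.snoc u 0 : Fin (d + 1) → ℝ) k • w k)]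
      simpa [pathLinear, smul_sub, Finset.sum_sub_distrib] using hu
  rcases d with _ | d
  · exact Subsingleton.elim _ _
  · ext i
    have h : ∀ i : Fin (d + 1), (Fin.cons 0 u : Fin (d + 2) → ℝ) i.castSucc = u i := fun i => by
      have := hl i.castSucc
      simp only [l, Fin.snoc_castSucc] at this
      linarith
    induction i using Fin.induction with
    | zero => simpa using (h 0).symm
    | succ i ih => rw [← h i.succ, Fin.castSucc_succ, Fin.cons_succ]; exact ih

theorem axisProj_pathSum {d : ℕ} [NeZero d] {k : ℕ} (w : Fin (k + 1) → EuclideanSpace ℝ (Fin d))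
    (u : Fin k → ℝ) : axisProj (pathSum w u) = pathSum (fun i => axisProj (w i)) u := by
  simp [axisProj, pathSum]

theorem measurable_axisProj {d : ℕ} [NeZero d] :
    Measurable (axisProj : EuclideanSpace ℝ (Fin d) → ℝ) := by
  unfold axisProj; fun_prop

/-- Uniqueness of Haar measure supplies the scaling constant of the affine parametrization. Its
value follows in `projectedMeasure_convexHull` from total masses, without a determinant. -/
theorem exists_projectedMeasure_convexHull_eq_smul {d : ℕ} [NeZero d]
    {w : Fin (d + 1) → EuclideanSpace ℝ (Fin d)} (hw : AffineIndependent ℝ w) :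
    ∃ c : ENNReal, c ≠ ⊤ ∧ projectedMeasure (convexHull ℝ (Set.range w)) =
      c • simplexMeasure fun i => axisProj (w i) := by
  let L : (Fin d → ℝ) ≃ₗ[ℝ] EuclideanSpace ℝ (Fin d) :=
    LinearEquiv.ofInjectiveOfFinrankEq (pathLinear w) (pathLinear_injective hw) (by simp)
  let e : (Fin d → ℝ) ≃L[ℝ] EuclideanSpace ℝ (Fin d) := L.toContinuousLinearEquiv
  let g : (Fin d → ℝ) ≃ₜ EuclideanSpace ℝ (Fin d) :=
    e.toHomeomorph.trans (Homeomorph.addLeft (w 0))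
  have hg : ⇑g = pathSum w := rfl
  have hHaar : ((volume : Measure (Fin d → ℝ)).map e).IsAddHaarMeasure :=
    e.isAddHaarMeasure_map volume
  obtain ⟨c, hc0, hct, hc⟩ : ∃ c : ENNReal, c ≠ 0 ∧ c ≠ ⊤ ∧
      (volume : Measure (Fin d → ℝ)).map e = c • volume :=
    ⟨_, by exact_mod_cast (Measure.addHaarScalarFactor_pos_of_isAddHaarMeasure
      ((volume : Measure (Fin d → ℝ)).map e) volume).ne', ENNReal.coe_ne_top,
      Measure.isAddLeftInvariant_eq_smul _ _⟩
  have hmap : (volume : Measure (Fin d → ℝ)).map g = c • volume := by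
    have : ⇑g = (fun v => w 0 + v) ∘ e := rfl
    rw [this, ← Measure.map_map (measurable_const_add _) e.continuous.measurable, hc,
      Measure.map_smul, map_add_left_eq_self]
  have himg : g.toMeasurableEquiv ⁻¹' (convexHull ℝ (Set.range w)) = orderSimplex d := by
    rw [convexHull_range_eq_image_orderSimplex, ← hg]
    exact Set.preimage_image_eq _ g.injective
  have hres : (volume.restrict (orderSimplex d)).map g =
      c • volume.restrict (convexHull ℝ (Set.range w)) := by
    have h := g.toMeasurableEquiv.restrict_map volume (convexHull ℝ (Set.range w))
    rw [himg] at h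
    change (Measure.map g volume).restrict _ = Measure.map g _ at h
    rw [← h, hmap, Measure.restrict_smul]
  refine ⟨c⁻¹, by simpa using hc0, ?_⟩
  have h1 : (simplexMeasure fun i => axisProj (w i)) =
      c • projectedMeasure (convexHull ℝ (Set.range w)) := by
    rw [projectedMeasure, ← Measure.map_smul, ← hres, Measure.map_map measurable_axisProj g.continuous.measurable,
      simplexMeasure]
    congr 1
    ext u
    exact (axisProj_pathSum w u).symm
  rw [h1, smul_smul, ENNReal.inv_mul_cancel hc0 hct, one_smul]

theorem projectedMeasure_convexHull {d : ℕ} [NeZero d]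
    {w : Fin (d + 1) → EuclideanSpace ℝ (Fin d)} (hw : AffineIndependent ℝ w) :
    projectedMeasure (convexHull ℝ (Set.range w)) =
      ENNReal.ofReal (d.factorial * volume.real (convexHull ℝ (Set.range w))) •
        simplexMeasure fun i => axisProj (w i) := by
  obtain ⟨c, hct, hc⟩ := exists_projectedMeasure_convexHull_eq_smul hw
  have h1 : volume.real (convexHull ℝ (Set.range w)) = c.toReal * (1 / d.factorial) := by
    have := congrArg (fun μ : Measure ℝ => μ.real Set.univ) hc
    simp only [projectedMeasure, measureReal_ennreal_smul_apply] at this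
    rw [map_measureReal_apply measurable_axisProj MeasurableSet.univ] at this
    rw [← measureReal_simplexMeasure_univ (fun i => axisProj (w i)), ← this]
    simp
  rw [hc, h1]
  congr 1
  rw [← ENNReal.ofReal_toReal hct]
  congr 1
  have : (d.factorial : ℝ) ≠ 0 := by exact_mod_cast d.factorial_ne_zero
  rw [ENNReal.toReal_ofReal ENNReal.toReal_nonneg]
  field_simp

/-- A full-dimensional simplex lies in no hyperplane of constant first coordinate. -/
theorem axisProj_zero_lt_last {d : ℕ} [NeZero d]
    {w : Fin (d + 1) → EuclideanSpace ℝ (Fin d)} (hw : AffineIndependent ℝ w)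
    (hy : Monotone fun i => axisProj (w i)) : axisProj (w 0) < axisProj (w (Fin.last d)) := by
  by_contra h
  have hc := monotone_eq_const hy (not_lt.1 h)
  have hs : Function.Surjective (pathLinear w) :=
    ((pathLinear w).injective_iff_surjective_of_finrank_eq_finrank (by simp)).1
      (pathLinear_injective hw)
  obtain ⟨u, hu⟩ := hs (EuclideanSpace.single 0 1)
  have h1 := axisProj_pathSum w u
  rw [hc, pathSum_const] at h1
  have h2 : pathSum w u = w 0 + pathLinear w u := rfl
  rw [h2, hu] at h1
  simp [axisProj] at h1

/-! ### Regular triangulation up to null sets -/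

section Triangulation

variable {ι E : Type*} [Fintype ι] [NormedAddCommGroup E] [NormedSpace ℝ E]

theorem mem_convexHull_image_finset_iff (v : ι → E) (A : Finset ι) (z : E) :
    z ∈ convexHull ℝ (v '' A) ↔ ∃ w : ι → ℝ, (∀ i, 0 ≤ w i) ∧ (∀ i, i ∉ A → w i = 0) ∧
      ∑ i, w i = 1 ∧ ∑ i, w i • v i = z := by
  classical
  constructor
  · intro hz
    let C : Set E := {z | ∃ w : ι → ℝ, (∀ i, 0 ≤ w i) ∧ (∀ i, i ∉ A → w i = 0) ∧
      ∑ i, w i = 1 ∧ ∑ i, w i • v i = z}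
    have hC : Convex ℝ C := by
      rintro x ⟨w, h0, hA, h1, rfl⟩ y ⟨w', h0', hA', h1', rfl⟩ a b ha hb hab
      refine ⟨fun i => a * w i + b * w' i, fun i => add_nonneg (mul_nonneg ha (h0 i))
        (mul_nonneg hb (h0' i)), fun i hi => by simp [hA i hi, hA' i hi], ?_, ?_⟩
      · rw [Finset.sum_add_distrib, ← Finset.mul_sum, ← Finset.mul_sum, h1, h1']; simpa
      · simp only [add_smul, mul_smul, Finset.sum_add_distrib, Finset.smul_sum]
    refine convexHull_min (t := C) ?_ hC hz
    rintro _ ⟨a, ha, rfl⟩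
    refine ⟨Pi.single a 1, fun i => ?_, fun i hi => ?_, by simp, ?_⟩
    · by_cases h : i = a
      · subst h; simp
      · simp [h]
    · have : i ≠ a := fun h => hi (h ▸ ha)
      simp [this]
    · simp [Pi.single_apply]
  · rintro ⟨w, h0, hA, h1, rfl⟩
    rw [← Finset.sum_subset A.subset_univ fun i _ hi => hA i hi] at h1
    rw [← Finset.sum_subset A.subset_univ fun i _ hi => by simp [hA i hi]]
    exact (convex_convexHull ℝ _).sum_mem (fun i _ => h0 i) h1
      fun i hi => subset_convexHull ℝ _ ⟨i, hi, rfl⟩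

/-- A cell of the regular subdivision of the points `v` induced by the heights `h` that is a simplex
of full dimension: the affine function `f + c` is a lower bound for the heights that is attained
exactly on `A`. -/
structure IsLowerCell (v : ι → E) (h : ι → ℝ) (A : Finset ι) : Prop where
  affineIndependent : AffineIndependent ℝ fun a : A => v a
  affineSpan_eq_top : affineSpan ℝ (v '' A) = ⊤
  exists_support : ∃ (f : E →ₗ[ℝ] ℝ) (c : ℝ), ∀ i, f (v i) + c ≤ h i ∧ (f (v i) + c = h i ↔ i ∈ A)

theorem eqOn_of_affineSpan_eq_top {s : Set E} (hs : affineSpan ℝ s = ⊤) {f : E →ₗ[ℝ] ℝ} {c : ℝ}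
    (h : ∀ x ∈ s, f x + c = 0) (x : E) : f x + c = 0 := by
  have := AffineMap.ext_on (f := f.toAffineMap + AffineMap.const ℝ E c)
    (g := AffineMap.const ℝ E (0 : ℝ)) hs (fun x hx => by simpa using h x hx)
  simpa using congrArg (fun g : E →ᵃ[ℝ] ℝ => g x) this

/-- For A spanning and j ∉ A, the heights interpolated on A ∪ {j} by an affine function form a
proper subspace: an affine function vanishing on A vanishes everywhere, so the indicator of j is
missed. Finitely many proper subspaces do not cover the space. -/
theorem exists_generic_heights (v : ι → E) : ∃ h : ι → ℝ, ∀ A : Finset ι,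
    affineSpan ℝ (v '' A) = ⊤ → ∀ (f : E →ₗ[ℝ] ℝ) (c : ℝ), (∀ i ∈ A, f (v i) + c = h i) →
      ∀ i, i ∉ A → f (v i) + c ≠ h i := by
  classical
  let H : Finset ι → ι → Submodule ℝ (ι → ℝ) := fun A j =>
    { carrier := {h | ∃ (f : E →ₗ[ℝ] ℝ) (c : ℝ), ∀ i ∈ insert j A, f (v i) + c = h i}
      zero_mem' := ⟨0, 0, by simp⟩
      add_mem' := by
        rintro h h' ⟨f, c, hf⟩ ⟨f', c', hf'⟩
        refine ⟨f + f', c + c', fun i hi => ?_⟩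
        rw [Pi.add_apply, ← hf i hi, ← hf' i hi, LinearMap.add_apply]
        ring
      smul_mem' := by
        rintro a h ⟨f, c, hf⟩
        refine ⟨a • f, a * c, fun i hi => ?_⟩
        rw [Pi.smul_apply, ← hf i hi, LinearMap.smul_apply, smul_eq_mul, smul_eq_mul]
        ring }
  let S : Finset (Finset ι × ι) :=
    Finset.univ.filter fun p => affineSpan ℝ (v '' p.1) = ⊤ ∧ p.2 ∉ p.1
  have hS : (⊤ : Submodule ℝ (ι → ℝ)) ∉ S.image fun p => H p.1 p.2 := by
    intro htop
    obtain ⟨⟨A, j⟩, hp, hAj⟩ := Finset.mem_image.1 htop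
    obtain ⟨hA, hj⟩ : affineSpan ℝ (v '' A) = ⊤ ∧ j ∉ A := by simpa [S] using hp
    have hmem : Pi.single j 1 ∈ H A j := by rw [hAj]; trivial
    obtain ⟨f, c, hfc⟩ := hmem
    have h0 := eqOn_of_affineSpan_eq_top hA (f := f) (c := c) (by
      rintro _ ⟨i, hi, rfl⟩
      have hij : i ≠ j := fun h => hj (h ▸ hi)
      simpa [hij] using hfc i (Finset.mem_insert_of_mem hi)) (v j)
    have h1 := hfc j (Finset.mem_insert_self _ _)
    rw [h0] at h1
    simp at h1
  have := Subspace.biUnion_ne_univ_of_top_notMem hS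
  obtain ⟨h, hh⟩ := (Set.ne_univ_iff_exists_notMem _).1 this
  refine ⟨h, fun A hA f c hfc j hj hfj => hh ?_⟩
  refine Set.mem_biUnion (Finset.mem_image_of_mem (fun p : Finset ι × ι => H p.1 p.2)
    (a := (A, j)) (by simp [S, hA, hj])) ?_
  refine ⟨f, c, fun i hi => ?_⟩
  rcases Finset.mem_insert.1 hi with rfl | hi
  · exact hfj
  · exact hfc i hi

theorem exists_pos_mul_abs_le (w g : ι → ℝ) (hw : ∀ i, 0 ≤ w i) (hg : ∀ i, w i = 0 → 0 ≤ g i) :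
    ∃ ε > 0, ∀ i, 0 ≤ w i + ε * g i := by
  have h : ∀ i, ∀ᶠ ε in nhdsWithin (0 : ℝ) (Set.Ioi 0), 0 ≤ w i + ε * g i := by
    intro i
    rcases (hw i).eq_or_lt with h | h
    · filter_upwards [self_mem_nhdsWithin] with ε hε
      rw [← h, zero_add]
      exact mul_nonneg (Set.mem_Ioi.1 hε).le (hg i h.symm)
    · have hc : Filter.Tendsto (fun ε : ℝ => w i + ε * g i) (nhds 0) (nhds (w i + 0 * g i)) :=
        Continuous.tendsto (by fun_prop) 0
      rw [zero_mul, add_zero] at hc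
      exact ((hc.eventually (lt_mem_nhds h)).filter_mono nhdsWithin_le_nhds).mono fun _ => le_of_lt
  obtain ⟨ε, hε, h0⟩ := ((Filter.eventually_all.2 h).and self_mem_nhdsWithin).exists
  exact ⟨ε, h0, hε⟩

/-- A basic optimal solution of the linear program that computes the lower hull at `z`. -/
theorem exists_basic_optimal (v : ι → E) (h : ι → ℝ) {z : E}
    (hz : z ∈ convexHull ℝ (Set.range v)) :
    ∃ w : ι → ℝ, (∀ i, 0 ≤ w i) ∧ ∑ i, w i = 1 ∧ ∑ i, w i • v i = z ∧
      (∀ g : ι → ℝ, (∀ i, w i = 0 → 0 ≤ g i) → ∑ i, g i = 0 → ∑ i, g i • v i = 0 →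
        0 ≤ ∑ i, g i * h i) ∧
      ∀ g : ι → ℝ, (∀ i, w i = 0 → g i = 0) → ∑ i, g i = 0 → ∑ i, g i • v i = 0 → g = 0 := by
  classical
  let K : Set (ι → ℝ) := {w | w ∈ stdSimplex ℝ ι ∧ ∑ i, w i • v i = z}
  have hK : IsCompact K := by
    refine (isCompact_stdSimplex ℝ ι).inter_right (isClosed_eq ?_ continuous_const)
    fun_prop
  have hKne : K.Nonempty := by
    have h1 : Set.range v = v '' (Finset.univ : Finset ι) := by simp
    rw [h1, mem_convexHull_image_finset_iff] at hz
    obtain ⟨w, h0, -, h1, h2⟩ := hz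
    exact ⟨w, ⟨h0, h1⟩, h2⟩
  have hcost : Continuous fun w : ι → ℝ => ∑ i, w i * h i := by fun_prop
  obtain ⟨w₀, hw₀, hmin⟩ := hK.exists_isMinOn hKne hcost.continuousOn
  let M : Set (ι → ℝ) := K ∩ {w | ∑ i, w i * h i = ∑ i, w₀ i * h i}
  have hM : IsCompact M := hK.inter_right (isClosed_eq hcost continuous_const)
  -- Extremality within the set of optimal weights is what makes the support of w affinely
  -- independent.
  obtain ⟨w, hwM, hext⟩ := hM.extremePoints_nonempty ⟨w₀, hw₀, rfl⟩
  obtain ⟨⟨⟨h0, h1⟩, h2⟩, hw⟩ := hwM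
  have hw : ∑ i, w i * h i = ∑ i, w₀ i * h i := hw
  have hpert : ∀ g : ι → ℝ, (∀ i, w i = 0 → 0 ≤ g i) → ∑ i, g i = 0 → ∑ i, g i • v i = 0 →
      ∃ ε > 0, (fun i => w i + ε * g i) ∈ K := by
    intro g hg hg1 hg2
    obtain ⟨ε, hε, hpos⟩ := exists_pos_mul_abs_le w g h0 hg
    refine ⟨ε, hε, ⟨hpos, ?_⟩, ?_⟩
    · rw [Finset.sum_add_distrib, ← Finset.mul_sum, hg1, h1]; simp
    · simp only [add_smul, mul_smul, Finset.sum_add_distrib, ← Finset.smul_sum]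
      rw [hg2, h2]; simp
  have hsum : ∀ (g : ι → ℝ) (ε : ℝ), ∑ i, (w i + ε * g i) * h i =
      ∑ i, w₀ i * h i + ε * ∑ i, g i * h i := by
    intro g ε
    rw [← hw, Finset.mul_sum, ← Finset.sum_add_distrib]
    exact Finset.sum_congr rfl fun i _ => by ring
  have hopt : ∀ g : ι → ℝ, (∀ i, w i = 0 → 0 ≤ g i) → ∑ i, g i = 0 → ∑ i, g i • v i = 0 →
      0 ≤ ∑ i, g i * h i := by
    intro g hg hg1 hg2
    obtain ⟨ε, hε, hmem⟩ := hpert g hg hg1 hg2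
    have := hmin hmem
    simp only [Set.mem_ofPred_eq, hsum] at this
    exact nonneg_of_mul_nonneg_right (by linarith) hε
  refine ⟨w, h0, h1, h2, hopt, fun g hg hg1 hg2 => ?_⟩
  have hneg1 : ∑ i, (-g) i = 0 := by simp [hg1]
  have hneg2 : ∑ i, (-g) i • v i = 0 := by simp [hg2]
  have hneg : ∀ i, w i = 0 → 0 ≤ (-g) i := fun i hi => by simp [hg i hi]
  have hzero : ∑ i, g i * h i = 0 := by
    refine le_antisymm ?_ (hopt g (fun i hi => (hg i hi).ge) hg1 hg2)
    have := hopt (-g) hneg hneg1 hneg2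
    simp only [Pi.neg_apply, neg_mul, Finset.sum_neg_distrib] at this
    linarith
  obtain ⟨ε, hε, hmem⟩ := hpert g (fun i hi => (hg i hi).ge) hg1 hg2
  obtain ⟨ε', hε', hmem'⟩ := hpert (-g) hneg hneg1 hneg2
  have hx : (fun i => w i + ε * g i) ∈ M := ⟨hmem, by
    simp only [Set.mem_ofPred_eq, hsum, hzero, mul_zero, add_zero]⟩
  have hx' : (fun i => w i + ε' * (-g) i) ∈ M := ⟨hmem', by
    simp only [Set.mem_ofPred_eq, hsum, Pi.neg_apply, neg_mul, Finset.sum_neg_distrib, hzero,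
      neg_zero, mul_zero, add_zero]⟩
  have hseg : w ∈ openSegment ℝ (fun i => w i + ε * g i) (fun i => w i + ε' * (-g) i) := by
    -- These weights make the displacements ε * g and -ε' * g cancel.
    refine ⟨ε' / (ε + ε'), ε / (ε + ε'), by positivity, by positivity, ?_, ?_⟩
    · field_simp; ring
    · ext i
      simp only [Pi.add_apply, Pi.smul_apply, smul_eq_mul, Pi.neg_apply]
      field_simp
      ring
  have := hext hx hx' hseg
  ext i
  have hi := congrFun this i
  have : ε * g i = 0 := by linarith
  simpa [hε.ne'] using this

/-- `z` lies on no affine subspace spanned by some of the points `v`, except the whole space. -/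
def IsOffProperSpans (v : ι → E) (z : E) : Prop :=
  ∀ A : Finset ι, z ∈ affineSpan ℝ (v '' A) → affineSpan ℝ (v '' A) = ⊤

theorem affineIndependent_finset_iff {v : ι → E} {A : Finset ι} :
    (AffineIndependent ℝ fun a : A => v a) ↔ ∀ g : ι → ℝ, (∀ i, i ∉ A → g i = 0) →
      ∑ i, g i = 0 → ∑ i, g i • v i = 0 → g = 0 := by
  have hs1 : ∀ g : ι → ℝ, (∀ i, i ∉ A → g i = 0) → ∑ i, g i = ∑ a : A, g a := fun g hg => by
    rw [← Finset.sum_subset A.subset_univ fun i _ hi => hg i hi, ← Finset.sum_coe_sort]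
  have hs2 : ∀ g : ι → ℝ, (∀ i, i ∉ A → g i = 0) →
      ∑ i, g i • v i = ∑ a : A, g a • v a := fun g hg => by
    rw [← Finset.sum_subset A.subset_univ fun i _ hi => by simp [hg i hi],
      ← Finset.sum_coe_sort A fun i => g i • v i]
  rw [affineIndependent_iff_of_fintype]
  constructor
  · intro h g hg h1 h2
    rw [hs1 g hg] at h1
    rw [hs2 g hg] at h2
    have := h (fun a => g a) h1 (by
      rwa [Finset.weightedVSub_eq_linear_combination _ h1])
    ext i
    by_cases hi : i ∈ A
    · exact this ⟨i, hi⟩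
    · exact hg i hi
  · intro h w h1 h2 a
    rw [Finset.weightedVSub_eq_linear_combination _ h1] at h2
    let g : ι → ℝ := Function.extend Subtype.val w 0
    have hga : ∀ a : A, g a = w a := fun a => Subtype.val_injective.extend_apply w 0 a
    have hg : ∀ i, i ∉ A → g i = 0 := fun i hi =>
      Function.extend_apply' _ _ _ (by rintro ⟨a, rfl⟩; exact hi a.2)
    have := h g hg (by rw [hs1 g hg]; simpa [hga] using h1) (by rw [hs2 g hg]; simpa [hga] using h2)
    rw [← hga, this]; rfl

/-- Linear programming duality: A is the support of a basic optimal solution at z, and spans because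
z is generic. The affine function interpolating the heights on A is the dual solution: optimality
puts it below all heights, and genericity of h excludes equality off A. -/
theorem exists_isLowerCell_mem_convexHull {v : ι → E} {h : ι → ℝ}
    (hgen : ∀ A : Finset ι, affineSpan ℝ (v '' A) = ⊤ → ∀ (f : E →ₗ[ℝ] ℝ) (c : ℝ),
      (∀ i ∈ A, f (v i) + c = h i) → ∀ i, i ∉ A → f (v i) + c ≠ h i)
    {z : E} (hz : z ∈ convexHull ℝ (Set.range v)) (hzg : IsOffProperSpans v z) :
    ∃ A, IsLowerCell v h A ∧ z ∈ convexHull ℝ (v '' A) := by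
  classical
  obtain ⟨w, h0, h1, h2, hopt, hind⟩ := exists_basic_optimal v h hz
  let A : Finset ι := Finset.univ.filter fun i => w i ≠ 0
  have hA : ∀ i, i ∉ A ↔ w i = 0 := fun i => by simp [A]
  have hzA : z ∈ convexHull ℝ (v '' A) :=
    (mem_convexHull_image_finset_iff v A z).2 ⟨w, h0, fun i => (hA i).1, h1, h2⟩
  have hspan := hzg A (convexHull_subset_affineSpan _ hzA)
  have hAI : AffineIndependent ℝ fun a : A => v a :=
    affineIndependent_finset_iff.2 fun g hg => hind g fun i hi => hg i ((hA i).2 hi)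
  refine ⟨A, ⟨hAI, hspan, ?_⟩, hzA⟩
  let b : AffineBasis A ℝ E := ⟨fun a : A => v a, hAI, by
    rw [← hspan, Set.image_eq_range]; rfl⟩
  let f : E →ₗ[ℝ] ℝ := ∑ a : A, h a • (b.coord a).linear
  let c : ℝ := ∑ a : A, h a * b.coord a 0
  have hfc : ∀ x, f x + c = ∑ a : A, h a * b.coord a x := by
    intro x
    simp only [f, c, LinearMap.sum_apply, LinearMap.smul_apply, smul_eq_mul,
      ← Finset.sum_add_distrib, ← mul_add]
    refine Finset.sum_congr rfl fun a _ => ?_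
    have := congrFun (AffineMap.decomp (b.coord a)) x
    simp only [Pi.add_apply] at this
    rw [this]
  have hfA : ∀ i ∈ A, f (v i) + c = h i := by
    intro i hi
    rw [hfc]
    have hb : v i = b ⟨i, hi⟩ := rfl
    simp [hb, AffineBasis.coord_apply]
  refine ⟨f, c, fun s => ⟨?_, ?_⟩⟩
  · let β : ι → ℝ := Function.extend Subtype.val (fun a : A => b.coord a (v s)) 0
    have hβa : ∀ a : A, β a = b.coord a (v s) := fun a =>
      Subtype.val_injective.extend_apply (fun a : A => b.coord a (v s)) 0 a
    have hβ : ∀ i, i ∉ A → β i = 0 := fun i hi =>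
      Function.extend_apply' _ _ _ (by rintro ⟨a, rfl⟩; exact hi a.2)
    have e1 : ∑ i, β i = 1 := by
      rw [← Finset.sum_subset A.subset_univ fun i _ hi => hβ i hi, ← Finset.sum_coe_sort]
      simpa [hβa] using b.sum_coord_apply_eq_one (v s)
    have e2 : ∑ i, β i • v i = v s := by
      rw [← Finset.sum_subset A.subset_univ fun i _ hi => by simp [hβ i hi],
        ← Finset.sum_coe_sort A fun i => β i • v i]
      simp only [hβa]
      exact b.linear_combination_coord_eq_self (v s)
    have e3 : ∑ i, β i * h i = f (v s) + c := by
      rw [← Finset.sum_subset A.subset_univ fun i _ hi => by simp [hβ i hi],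
        ← Finset.sum_coe_sort A fun i => β i * h i, hfc]
      exact Finset.sum_congr rfl fun a _ => by rw [hβa, mul_comm]
    -- Replacing the barycentric representation β of v s by the point v s itself is an admissible
    -- direction, nonnegative off A; its cost is h s - (f (v s) + c).
    have := hopt (fun i => (Pi.single s 1 : ι → ℝ) i - β i) (fun i hi => by
        rw [hβ i ((hA i).2 hi), sub_zero]
        by_cases his : i = s
        · subst his; simp
        · simp [his])
      (by rw [Finset.sum_sub_distrib, e1]; simp)
      (by simp only [sub_smul, Finset.sum_sub_distrib]; rw [e2]; simp [Pi.single_apply])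
    simp only [sub_mul, Finset.sum_sub_distrib] at this
    rw [e3] at this
    simp only [Pi.single_apply, ite_mul, one_mul, zero_mul, Finset.sum_ite_eq',
      Finset.mem_univ, if_true] at this
    linarith
  · refine ⟨fun hs => ?_, hfA s⟩
    by_contra hsA
    exact hgen A hspan f c hfA s hsA hs

/-- Evaluation at z in the barycentric coordinates of B gives f + c ≤ f' + c' there. In those of A
the same values differ by a nonnegative sum, so every term vanishes. No vertex of A has weight zero,
since z would lie in the span of a proper face; hence f' + c' attains the height at each vertex of
A. -/
theorem IsLowerCell.subset_of_mem {v : ι → E} {h : ι → ℝ} {A B : Finset ι}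
    (hA : IsLowerCell v h A) (hB : IsLowerCell v h B) {z : E} (hzg : IsOffProperSpans v z)
    (hzA : z ∈ convexHull ℝ (v '' A)) (hzB : z ∈ convexHull ℝ (v '' B)) : A ⊆ B := by
  classical
  obtain ⟨f, c, hf⟩ := hA.exists_support
  obtain ⟨f', c', hf'⟩ := hB.exists_support
  have heval : ∀ (f : E →ₗ[ℝ] ℝ) (c : ℝ) (w : ι → ℝ), ∑ i, w i = 1 → ∑ i, w i • v i = z →
      f z + c = ∑ i, w i * (f (v i) + c) := by
    intro f c w h1 h2
    rw [← h2, map_sum]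
    simp only [map_smul, smul_eq_mul, mul_add, Finset.sum_add_distrib, ← Finset.sum_mul, h1, one_mul]
  obtain ⟨w, h0, hwA, h1, h2⟩ := (mem_convexHull_image_finset_iff v A z).1 hzA
  obtain ⟨w', h0', hwB, h1', h2'⟩ := (mem_convexHull_image_finset_iff v B z).1 hzB
  have hle : f z + c ≤ f' z + c' := by
    rw [heval f c w' h1' h2', heval f' c' w' h1' h2']
    refine Finset.sum_le_sum fun i _ => ?_
    by_cases hi : i ∈ B
    · rw [(hf' i).2.2 hi]
      exact mul_le_mul_of_nonneg_left (hf i).1 (h0' i)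
    · simp [hwB i hi]
  have hterm : ∀ i, 0 ≤ w i * ((f (v i) + c) - (f' (v i) + c')) := by
    intro i
    by_cases hi : i ∈ A
    · rw [(hf i).2.2 hi]
      exact mul_nonneg (h0 i) (sub_nonneg.2 (hf' i).1)
    · simp [hwA i hi]
  have hsum : ∑ i, w i * ((f (v i) + c) - (f' (v i) + c')) = 0 := by
    refine le_antisymm ?_ (Finset.sum_nonneg fun i _ => hterm i)
    simp only [mul_sub, Finset.sum_sub_distrib]
    rw [← heval f c w h1 h2, ← heval f' c' w h1 h2]
    linarith
  have hzero := (Finset.sum_eq_zero_iff_of_nonneg fun i _ => hterm i).1 hsum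
  intro a ha
  have hwa : w a ≠ 0 := by
    intro hwa
    have hz : z ∈ convexHull ℝ (v '' (A.erase a : Finset ι)) := by
      refine (mem_convexHull_image_finset_iff v _ z).2 ⟨w, h0, fun i hi => ?_, h1, h2⟩
      by_cases hia : i = a
      · rw [hia, hwa]
      · exact hwA i fun h => hi (Finset.mem_erase.2 ⟨hia, h⟩)
    have htop := hzg _ (convexHull_subset_affineSpan _ hz)
    have hnot := hA.affineIndependent.notMem_affineSpan_sdiff ⟨a, ha⟩ Set.univ
    have himg : (fun a : A => v a) '' (Set.univ \ {⟨a, ha⟩}) = v '' (A.erase a : Finset ι) := by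
      ext y
      constructor
      · rintro ⟨⟨i, hi⟩, ⟨-, hne⟩, rfl⟩
        exact ⟨i, by simpa [hi] using hne, rfl⟩
      · rintro ⟨i, hi, rfl⟩
        have hi' := Finset.mem_erase.1 (Finset.mem_coe.1 hi)
        exact ⟨⟨i, hi'.2⟩, ⟨trivial, by simpa using hi'.1⟩, rfl⟩
    rw [himg, htop] at hnot
    exact hnot trivial
  have := (mul_eq_zero.1 (hzero a (Finset.mem_univ a))).resolve_left hwa
  refine (hf' a).2.1 ?_
  rw [← (hf a).2.2 ha]
  linarith

variable [FiniteDimensional ℝ E] [MeasurableSpace E] [BorelSpace E]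

theorem ae_isGenericPoint (v : ι → E) (μ : Measure E) [μ.IsAddHaarMeasure] :
    ∀ᵐ z ∂μ, IsOffProperSpans v z := by
  refine (ae_all_iff.2 fun A => ?_)
  by_cases h : affineSpan ℝ (v '' A) = ⊤
  · exact ae_of_all _ fun _ _ => h
  · filter_upwards [compl_mem_ae_iff.2 (Measure.addHaar_affineSubspace μ _ h)] with z hz hz'
    exact (hz hz').elim

/-- A polytope is, up to null sets, the disjoint union of full-dimensional simplices whose vertices
are among the given points. -/
theorem exists_triangulation (v : ι → E) (μ : Measure E) [μ.IsAddHaarMeasure] :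
    ∃ F : Finset (Finset ι), (∀ A ∈ F, (AffineIndependent ℝ fun a : A => v a) ∧
        A.card = Module.finrank ℝ E + 1) ∧
      μ.restrict (convexHull ℝ (Set.range v)) =
        ∑ A ∈ F, μ.restrict (convexHull ℝ (v '' A)) := by
  classical
  obtain ⟨h, hgen⟩ := exists_generic_heights v
  let F : Finset (Finset ι) := Finset.univ.filter (IsLowerCell v h)
  have hF : ∀ A, A ∈ F ↔ IsLowerCell v h A := fun A => by simp [F]
  refine ⟨F, fun A hAF => ?_, ?_⟩
  · have hA := (hF A).1 hAF
    refine ⟨hA.affineIndependent, ?_⟩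
    have := hA.affineIndependent.affineSpan_eq_top_iff_card_eq_finrank_add_one.1 (by
      rw [← hA.affineSpan_eq_top, Set.image_eq_range]; rfl)
    simpa using this
  · have hae : convexHull ℝ (Set.range v) =ᵐ[μ] ⋃ A : F, convexHull ℝ (v '' (A : Finset ι)) := by
      filter_upwards [ae_isGenericPoint v μ] with z hz
      refine propext ⟨fun hzc => ?_, fun hzc => ?_⟩
      · obtain ⟨A, hA, hzA⟩ := exists_isLowerCell_mem_convexHull hgen hzc hz
        exact Set.mem_iUnion.2 ⟨⟨A, (hF A).2 hA⟩, hzA⟩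
      · obtain ⟨A, hzA⟩ := Set.mem_iUnion.1 hzc
        exact convexHull_mono (Set.image_subset_range _ _) hzA
    rw [Measure.restrict_congr_set hae, Measure.restrict_iUnion_ae, Measure.sum_fintype,
      Finset.sum_coe_sort F fun A => μ.restrict (convexHull ℝ (v '' A))]
    · intro A B hAB
      refine measure_mono_null (t := {z | ¬ IsOffProperSpans v z}) ?_ (ae_isGenericPoint v μ)
      rintro z ⟨hzA, hzB⟩ hz
      refine hAB (Subtype.ext ?_)
      have hA := (hF A).1 A.2
      have hB := (hF B).1 B.2
      exact (hA.subset_of_mem hB hz hzA hzB).antisymm (hB.subset_of_mem hA hz hzB hzA)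
    · intro A
      exact ((A.1.finite_toSet.image v).isClosed_convexHull ℝ).measurableSet.nullMeasurableSet

end Triangulation

/-! ### From simplices to the polytope -/

theorem projectedMeasure_eq_sum {d : ℕ} [NeZero d] {α : Type*} {F : Finset α}
    {P : Set (EuclideanSpace ℝ (Fin d))} {Q : α → Set (EuclideanSpace ℝ (Fin d))}
    (h : volume.restrict P = ∑ A ∈ F, volume.restrict (Q A)) :
    projectedMeasure P = ∑ A ∈ F, projectedMeasure (Q A) := by
  unfold projectedMeasure
  rw [h]
  have := map_sum (Measure.mapₗ (α := EuclideanSpace ℝ (Fin d)) (axisProj (d := d)))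
    (fun A => volume.restrict (Q A)) F
  simpa only [Measure.mapₗ_apply_of_measurable measurable_axisProj] using this

theorem IsConvexPolytope.eq_convexHull_range {d : ℕ} {P : Set (EuclideanSpace ℝ (Fin d))}
    (hP : IsConvexPolytope P) {n : ℕ} {v : Fin n → EuclideanSpace ℝ (Fin d)}
    (hv : Set.range v = P.extremePoints ℝ) : P = convexHull ℝ (Set.range v) := by
  obtain ⟨S, hS, hPS⟩ := hP.exists_finite
  have hcomp : IsCompact P := hPS ▸ hS.isCompact_convexHull ℝ
  have hconv : Convex ℝ P := hPS ▸ convex_convexHull ℝ S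
  have h := closure_convexHull_extremePoints hcomp hconv
  rw [← hv, ((Set.finite_range v).isClosed_convexHull ℝ).closure_eq] at h
  exact h.symm

/-- Vertices are indexed by increasing first coordinate, so enumerating a cell increasingly sorts
its knots. Injectivity of the enumeration later bounds knot multiplicities. -/
theorem exists_projectedMeasure_eq_sum_simplexMeasure {d : ℕ} [NeZero d] {n : ℕ} (hn : 0 < n)
    (v : Fin n → EuclideanSpace ℝ (Fin d)) (hmono : Monotone fun i => axisProj (v i)) :
    ∃ (F : Finset (Finset (Fin n))) (e : Finset (Fin n) → Fin (d + 1) → Fin n)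
      (C : Finset (Fin n) → ℝ), (∀ A ∈ F, Function.Injective (e A) ∧ Monotone (e A) ∧
        axisProj (v (e A 0)) < axisProj (v (e A (Fin.last d))) ∧ 0 ≤ C A) ∧
      projectedMeasure (convexHull ℝ (Set.range v)) =
        ∑ A ∈ F, ENNReal.ofReal (C A) • simplexMeasure fun i => axisProj (v (e A i)) := by
  obtain ⟨F, hF, hres⟩ := exists_triangulation v volume
  have he : ∀ A ∈ F, ∃ e : Fin (d + 1) → Fin n, Function.Injective e ∧ Monotone e ∧
      Set.range e = A ∧ AffineIndependent ℝ fun i => v (e i) := by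
    intro A hA
    obtain ⟨hAI, hcard⟩ := hF A hA
    rw [finrank_euclideanSpace_fin] at hcard
    refine ⟨A.orderEmbOfFin hcard, (A.orderEmbOfFin hcard).injective,
      (A.orderEmbOfFin hcard).monotone, A.range_orderEmbOfFin hcard, ?_⟩
    exact hAI.comp_embedding ⟨fun i => (⟨A.orderEmbOfFin hcard i, A.orderEmbOfFin_mem hcard i⟩ : A),
      fun i j hij => (A.orderEmbOfFin hcard).injective (congrArg Subtype.val hij)⟩
  have : Nonempty (Fin n) := ⟨⟨0, hn⟩⟩
  choose! e hinj hem hrange hAI using he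
  refine ⟨F, e, fun A => d.factorial * volume.real (convexHull ℝ (v '' A)), fun A hA =>
    ⟨hinj A hA, hem A hA, axisProj_zero_lt_last (hAI A hA) (hmono.comp (hem A hA)),
      by positivity⟩, ?_⟩
  rw [projectedMeasure_eq_sum hres]
  refine Finset.sum_congr rfl fun A hA => ?_
  have : v '' A = Set.range fun i => v (e A i) := by
    rw [← hrange A hA, ← Set.range_comp]; rfl
  simp only [this]
  exact projectedMeasure_convexHull (hAI A hA)

/-- If t lay outside the support, the preimage of a neighbourhood of t would be P-null. It is open
and contains a point of P, hence meets the interior of P in positive volume. -/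
theorem Icc_subset_tsupport_of_withDensity {d : ℕ} [NeZero d]
    {P : Set (EuclideanSpace ℝ (Fin d))} (hconv : Convex ℝ P) (hint : (interior P).Nonempty)
    {ρ : ℝ → ℝ}
    (hρ : projectedMeasure P = volume.withDensity fun t => ENNReal.ofReal (ρ t))
    {p q : EuclideanSpace ℝ (Fin d)} (hp : p ∈ P) (hq : q ∈ P) :
    Set.Icc (axisProj p) (axisProj q) ⊆ tsupport ρ := by
  have hc : Continuous (axisProj : EuclideanSpace ℝ (Fin d) → ℝ) := by
    unfold axisProj; fun_prop
  intro t ht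
  obtain ⟨z, hz, rfl⟩ := hconv.isPreconnected.intermediate_value hp hq hc.continuousOn ht
  by_contra hU
  have hUo : IsOpen (tsupport ρ)ᶜ := (isClosed_tsupport ρ).isOpen_compl
  have h0 : projectedMeasure P (tsupport ρ)ᶜ = 0 := by
    rw [hρ, withDensity_apply _ hUo.measurableSet]
    refine setLIntegral_eq_zero hUo.measurableSet fun s hs => ?_
    simp [image_eq_zero_of_notMem_tsupport hs]
  rw [projectedMeasure, Measure.map_apply measurable_axisProj hUo.measurableSet,
    Measure.restrict_apply (measurable_axisProj hUo.measurableSet)] at h0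
  have hzc : z ∈ closure (interior P) := by
    rw [hconv.closure_interior_eq_closure_of_nonempty_interior hint]
    exact subset_closure hz
  have hne := mem_closure_iff.1 hzc _ (hUo.preimage hc) hU
  have hpos := ((hUo.preimage hc).inter isOpen_interior).measure_pos volume hne
  exact hpos.ne' (measure_mono_null (Set.inter_subset_inter_right _ interior_subset) h0)

theorem IsConvexPolytope.interior_nonempty {d : ℕ} {P : Set (EuclideanSpace ℝ (Fin d))}
    (hP : IsConvexPolytope P) : (interior P).Nonempty := by
  obtain ⟨S, -, rfl⟩ := hP.exists_finite
  rw [interior_convexHull_nonempty_iff_affineSpan_eq_top, ← affineSpan_convexHull]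
  exact hP.full_dim

section Sum

variable {n d : ℕ} {x : Fin n → ℝ} {F : Finset (Finset (Fin n))}
  {e : Finset (Fin n) → Fin (d + 2) → Fin n} {C : Finset (Fin n) → ℝ} {μ : Measure ℝ}

theorem integral_sum_simplexMeasure (hC : ∀ A ∈ F, 0 ≤ C A)
    (hμ : μ = ∑ A ∈ F, ENNReal.ofReal (C A) • simplexMeasure fun i => x (e A i))
    {ψ : ℝ → ℝ} (hψ : Continuous ψ) :
    ∫ s, ψ s ∂μ = ∑ A ∈ F, C A * ∫ s, ψ s ∂simplexMeasure fun i => x (e A i) := by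
  rw [hμ, integral_finsetSum_measure fun A _ =>
    (hψ.integrable_simplexMeasure _).smul_measure ENNReal.ofReal_ne_top]
  refine Finset.sum_congr rfl fun A hA => ?_
  rw [integral_smul_measure, ENNReal.toReal_ofReal (hC A hA), smul_eq_mul]

theorem distribDeriv_sum_simplexMeasure_mem_diracSpan (hx : Monotone x)
    (he : ∀ A ∈ F, Function.Injective (e A) ∧ Monotone (e A)) (hC : ∀ A ∈ F, 0 ≤ C A)
    (hμ : μ = ∑ A ∈ F, ENNReal.ofReal (C A) • simplexMeasure fun i => x (e A i))
    [IsFiniteMeasure μ] :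
    distribDeriv (d + 1) (measureDistribution μ) ∈ diracSpan (knotMultiplicity x) := by
  have h : measureDistribution μ =
      ∑ A ∈ F, C A • measureDistribution (simplexMeasure fun i => x (e A i)) := by
    ext φ
    have h1 : ∀ G : Finset (Finset (Fin n)),
        (∑ A ∈ G, C A • measureDistribution (simplexMeasure fun i => x (e A i))) φ =
        ∑ A ∈ G, C A * measureDistribution (simplexMeasure fun i => x (e A i)) φ := by
      intro G
      classical
      induction G using Finset.induction_on with
      | empty => rfl
      | insert A G hA ih =>
        rw [Finset.sum_insert hA, Finset.sum_insert hA, ← ih]; rfl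
    rw [h1, measureDistribution_apply, integral_sum_simplexMeasure hC hμ φ.continuous]
    simp_rw [measureDistribution_apply]
  rw [h]
  change distribDerivLM (d + 1) _ ∈ _
  rw [map_sum]
  refine sum_mem fun A hA => ?_
  rw [map_smul]
  exact Submodule.smul_mem _ _ (diracSpan_mono (knotMultiplicity_comp_le x (he A hA).1)
    (distribDeriv_simplexMeasure_mem_diracSpan (hx.comp (he A hA).2)))

theorem integral_mul_sum_simplexDensity (hx : Monotone x)
    (he : ∀ A ∈ F, Monotone (e A)) (hlt : ∀ A ∈ F, x (e A 0) < x (e A (Fin.last (d + 1))))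
    (hC : ∀ A ∈ F, 0 ≤ C A)
    (hμ : μ = ∑ A ∈ F, ENNReal.ofReal (C A) • simplexMeasure fun i => x (e A i))
    {ψ : ℝ → ℝ} (hψ : Continuous ψ) :
    (Integrable fun s => ψ s * (∑ A ∈ F, C A • simplexDensity fun i => x (e A i)) s) ∧
    ∫ s, ψ s ∂μ = ∫ s, ψ s * (∑ A ∈ F, C A • simplexDensity fun i => x (e A i)) s := by
  have hi : ∀ A ∈ F, Integrable fun s =>
      C A * (ψ s * simplexDensity (fun i => x (e A i)) s) := fun A hA =>
    (integrable_mul_simplexDensity (hx.comp (he A hA)) hψ).const_mul _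
  have heq : (fun s => ψ s * (∑ A ∈ F, C A • simplexDensity fun i => x (e A i)) s) =
      fun s => ∑ A ∈ F, C A * (ψ s * simplexDensity (fun i => x (e A i)) s) := by
    ext s
    simp only [Finset.sum_apply, Pi.smul_apply, smul_eq_mul, Finset.mul_sum]
    exact Finset.sum_congr rfl fun A _ => by ring
  rw [heq]
  refine ⟨integrable_finsetSum _ hi, ?_⟩
  rw [integral_finsetSum _ hi, integral_sum_simplexMeasure hC hμ hψ]
  refine Finset.sum_congr rfl fun A hA => ?_
  rw [integral_const_mul, integral_simplexMeasure_eq_integral_density (y := fun i => x (e A i))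
    (hx.comp (he A hA))
    (hlt A hA) hψ]

theorem sum_simplexDensity_mem_truncSpan (hx : Monotone x)
    (he : ∀ A ∈ F, Function.Injective (e A) ∧ Monotone (e A)) :
    ∑ A ∈ F, C A • simplexDensity (fun i => x (e A i)) ∈ truncSpan d (knotMultiplicity x) :=
  sum_mem fun A hA => Submodule.smul_mem _ _
    (truncSpan_mono (knotMultiplicity_comp_le x (he A hA).1)
      (simplexDensity_mem_truncSpan (hx.comp (he A hA).2)))

theorem support_sum_simplexDensity_subset (hx : Monotone x) (he : ∀ A ∈ F, Monotone (e A))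
    {a b : ℝ} (ha : ∀ i, a ≤ x i) (hb : ∀ i, x i ≤ b) :
    Function.support (∑ A ∈ F, C A • simplexDensity fun i => x (e A i)) ⊆ Set.Icc a b := by
  intro s hs
  by_contra h
  refine hs ?_
  rw [Finset.sum_apply]
  refine Finset.sum_eq_zero fun A hA => ?_
  rw [Pi.smul_apply, simplexDensity_eq_zero (y := fun i => x (e A i)) (hx.comp (he A hA)), smul_zero]
  exact fun hs' => h ⟨(ha _).trans hs'.1, hs'.2.trans (hb _)⟩

end Sum

/-- Equality is tested on smooth functions. The factor (d + 1) / (b - a) of `bsplineDensity` times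
the factor d! (b - a) of `bspline_integral` is (d + 1)!. -/
theorem ae_eq_bsplineDensity_of_integral_eq {d : ℕ} {y : Fin (d + 2) → ℝ} (hy : Monotone y)
    (hlt : y 0 < y (Fin.last (d + 1))) {V : ℝ} {ρ : ℝ → ℝ} (hρ : Integrable ρ)
    (h : ∀ φ : ℝ → ℝ, ContDiff ℝ 1 φ →
      ∫ s, φ s * ρ s = (d + 1).factorial * V * ∫ s, φ s ∂simplexMeasure y) :
    ∀ᵐ t, ρ t = V * bsplineDensity (d + 1) y t := by
  obtain ⟨hint, hval⟩ := bspline_integral hy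
  have heq : (fun t => V * bsplineDensity (d + 1) y t) = fun t =>
      (V * ((d + 1 : ℕ) / (y (Fin.last (d + 1)) - y 0))) * bspline (d + 1) y t := by
    ext t; rw [bsplineDensity]; ring
  have hb : Integrable fun t => V * bsplineDensity (d + 1) y t := by
    rw [heq]
    simpa using (hint (fun _ => 1) continuous_const).const_mul _
  refine ae_eq_of_integral_contDiff_smul_eq hρ.locallyIntegrable hb.locallyIntegrable
    fun φ hφ _ => ?_
  have hφ1 : ContDiff ℝ 1 φ := hφ.of_le (by simp)
  have h2 : ∀ t, φ t * (V * bsplineDensity (d + 1) y t) =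
      (V * ((d + 1 : ℕ) / (y (Fin.last (d + 1)) - y 0))) * (φ t * bspline (d + 1) y t) := by
    intro t; rw [bsplineDensity]; ring
  simp only [smul_eq_mul, h2]
  rw [integral_const_mul, hval φ hφ1, h φ hφ1, Nat.factorial_succ]
  have : y (Fin.last (d + 1)) - y 0 ≠ 0 := (sub_pos.2 hlt).ne'
  push_cast
  field_simp

instance {d : ℕ} [NeZero d] {P : Set (EuclideanSpace ℝ (Fin d))}
    [IsFiniteMeasure (volume.restrict P)] : IsFiniteMeasure (projectedMeasure P) := by
  unfold projectedMeasure; infer_instance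

theorem mainTheorem11 {d : ℕ} [NeZero d] (P : Set (EuclideanSpace ℝ (Fin d)))
    (hP : IsConvexPolytope P) {n : ℕ} (hn : 0 < n)
    (v : Fin n → EuclideanSpace ℝ (Fin d)) (hv_inj : Function.Injective v)
    (hv : Set.range v = P.extremePoints ℝ)
    (x : Fin n → ℝ) (hx : ∀ i, x i = axisProj (v i)) (hx_mono : Monotone x) :
    (Function.Injective x ↔ Set.InjOn axisProj (P.extremePoints ℝ)) ∧
    ∃ ρ : ℝ → ℝ,
      Measurable ρ ∧ (∀ t, 0 ≤ ρ t) ∧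
      projectedMeasure P = volume.withDensity (fun t => ENNReal.ofReal (ρ t)) ∧
      Function.support ρ ⊆ Set.Icc (x ⟨0, hn⟩) (x ⟨n - 1, Nat.sub_one_lt_of_lt hn⟩) ∧
      tsupport ρ = Set.Icc (x ⟨0, hn⟩) (x ⟨n - 1, Nat.sub_one_lt_of_lt hn⟩) ∧
      -- piecewise polynomial of degree at most `d - 1`
      IsPiecewisePolynomial (d - 1) (Set.range x) ρ ∧
      -- smoothness: simple knots, and the loss of smoothness at multiple knots
      (Function.Injective x → 2 ≤ d → ContDiff ℝ ((d - 2 : ℕ) : WithTop ℕ∞) ρ) ∧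
      (∀ (t : ℝ) (k : ℕ), k + 1 + knotMultiplicity x t ≤ d →
        ContDiffAt ℝ (k : WithTop ℕ∞) ρ t) ∧
      -- the `d`-th distributional derivative: simple knots, and multiple knots
      (Function.Injective x → ∃ c : Fin n → ℝ,
        distribDeriv d (measureDistribution (projectedMeasure P)) =
          ∑ i, c i • diracDistribution (x i)) ∧
      (∃ c : ℝ → ℕ → ℝ,
        distribDeriv d (measureDistribution (projectedMeasure P)) =
          ∑ t ∈ Finset.univ.image x, ∑ j ∈ Finset.range (knotMultiplicity x t),
            c t j • distribDeriv j (diracDistribution t)) ∧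
      -- simplices
      (∀ w : Fin (d + 1) → EuclideanSpace ℝ (Fin d), AffineIndependent ℝ w →
        P = convexHull ℝ (Set.range w) → Monotone (fun i => axisProj (w i)) →
        ∀ᵐ t, ρ t = volume.real P * bsplineDensity d (fun i => axisProj (w i)) t) := by

  -- A density requires at least two knots, hence dimension at least one.
  obtain ⟨d, rfl⟩ : ∃ d', d = d' + 1 := ⟨d - 1, by have := NeZero.pos d; omega⟩
  obtain rfl : x = fun i => axisProj (v i) := funext hx
  have hPv := hP.eq_convexHull_range hv
  have hPc : IsCompact P := hPv ▸ (Set.finite_range v).isCompact_convexHull ℝ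
  have hconv : Convex ℝ P := hPv ▸ convex_convexHull ℝ _
  have hvP : ∀ i, v i ∈ P := fun i => hPv ▸ subset_convexHull ℝ _ ⟨i, rfl⟩
  have : IsFiniteMeasure (volume.restrict P) := ⟨by simpa using hPc.measure_lt_top⟩
  set x : Fin n → ℝ := fun i => axisProj (v i) with hxdef
  obtain ⟨F, e, C, hF, hμ⟩ := exists_projectedMeasure_eq_sum_simplexMeasure hn v hx_mono
  rw [← hPv] at hμ
  have he : ∀ A ∈ F, Function.Injective (e A) ∧ Monotone (e A) :=
    fun A hA => ⟨(hF A hA).1, (hF A hA).2.1⟩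
  have hC : ∀ A ∈ F, 0 ≤ C A := fun A hA => (hF A hA).2.2.2
  have hint : ∀ {ψ : ℝ → ℝ}, Continuous ψ → _ := fun hψ =>
    integral_mul_sum_simplexDensity (x := x) hx_mono (fun A hA => (he A hA).2)
      (fun A hA => (hF A hA).2.2.1) hC hμ hψ
  have hspan := sum_simplexDensity_mem_truncSpan (C := C) hx_mono he
  have hdirac := distribDeriv_sum_simplexMeasure_mem_diracSpan (x := x) hx_mono he hC hμ
  have hsupp := support_sum_simplexDensity_subset (C := C) hx_mono (fun A hA => (he A hA).2)
    (a := x ⟨0, hn⟩) (b := x ⟨n - 1, Nat.sub_one_lt_of_lt hn⟩)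
    (fun i => hx_mono (Fin.mk_le_of_le_val (Nat.zero_le _)))
    (fun i => hx_mono (Fin.le_def.2 (Nat.le_sub_one_of_lt i.2)))
  -- This explicit version of the density is needed because polynomiality, smoothness and support
  -- are claimed everywhere, not almost everywhere.
  set ρ : ℝ → ℝ := ∑ A ∈ F, C A • simplexDensity fun i => x (e A i) with hρdef
  have hρ0 : ∀ t, 0 ≤ ρ t := fun t => by
    rw [hρdef, Finset.sum_apply]
    exact Finset.sum_nonneg fun A hA =>
      mul_nonneg (hC A hA) (simplexDensity_nonneg (hx_mono.comp (he A hA).2) t)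
  have hρi : Integrable ρ := by simpa using (hint (ψ := fun _ => 1) continuous_const).1
  have hdens : projectedMeasure P = volume.withDensity fun t => ENNReal.ofReal (ρ t) :=
    withDensity_ofReal_eq_of_integral_eq hρ0 hρi fun ψ hψ => (hint hψ).2
  have hsmooth : ∀ (t : ℝ) (k : ℕ), k + 1 + knotMultiplicity x t ≤ d + 1 →
      ContDiffAt ℝ (k : WithTop ℕ∞) ρ t := fun t k hk =>
    contDiffAt_of_mem_truncSpan hspan (by omega)
  refine ⟨?_, ρ, ?_, hρ0, hdens, hsupp, ?_, ?_, ?_, hsmooth, ?_, ?_, ?_⟩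
  · rw [← hv]
    constructor
    · rintro h _ ⟨i, rfl⟩ _ ⟨j, rfl⟩ hij
      rw [h hij]
    · exact fun h i j hij => hv_inj (h ⟨i, rfl⟩ ⟨j, rfl⟩ hij)
  · have := Finset.measurable_sum F fun A _ =>
      (measurable_simplexDensity fun i => x (e A i)).const_smul (C A)
    convert this using 1
    ext s
    simp [hρdef]
  · exact (closure_minimal hsupp isClosed_Icc).antisymm
      (Icc_subset_tsupport_of_withDensity hconv hP.interior_nonempty hdens (hvP _) (hvP _))
  · exact isPiecewisePolynomial_of_mem_truncSpan (fun t => knotMultiplicity_pos_iff.1) hspan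
  · intro hinj hd
    rw [contDiff_iff_contDiffAt]
    intro t
    have := knotMultiplicity_le_one hinj t
    exact hsmooth t _ (by omega)
  · exact fun hinj => exists_coeff_of_mem_diracSpan_of_injective hinj hdirac
  · exact exists_coeff_of_mem_diracSpan hdirac
  -- Here P is treated as one simplex, independently of the triangulation defining ρ; the two
  -- descriptions are compared through their integrals.
  · intro w hw hPw hwm
    refine ae_eq_bsplineDensity_of_integral_eq hwm (axisProj_zero_lt_last hw hwm) hρi
      fun φ hφ => ?_
    rw [← (hint hφ.continuous).2, hPw, projectedMeasure_convexHull hw, integral_smul_measure,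
      ENNReal.toReal_ofReal (by positivity), smul_eq_mul]
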